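/- **Theorem 2.** Let $L$ be the first-order language with the Boolean symbols $0,1,\cap,\cup,\neg$, unary predicates $C_n$ for all integers $n\ge 1$, and one further unary predicate $Fin$. Write $x\le y$ for $x\cap y=x$, $x<y$ for $x\le y\wedge x\neq y$, $x-y$ for $x\cap\neg y$, and (for $n\ge 0$) $\sharp(x)\le n$ for $\neg C_{n+1}(x)$. An atom is a nonzero element $a$ such that every $y\le a$ is $0$ or $a$. Let $T_2$ be the $L$-theory with the following axioms: 1. the axioms of Boolean algebras, the sentences saying that the algebra is infinite, and the sentence saying that every nonzero element has an atom below it; 2. for each $n\ge 1$, the defining axiom of $C_n$: for all $x$, $C_n(x)$ holds if and only if there are at least $n$ distinct atoms $\alpha\le x$; 3. $Fin$ is a proper ideal: $Fin(0)$, $\neg Fin(1)$, $Fin$ is closed under $\cup$, and $y\le x\wedge Fin(x)$ implies $Fin(y)$; 4. for each $n\ge 0$, $\forall x\,(\sharp(x)\le n\Rightarrow Fin(x))$; 5. (Main Axiom) $\forall x\,\bigl(\neg Fin(x)\Rightarrow \exists y\,(y<x\wedge\neg Fin(y)\wedge\neg Fin(x-y))\bigr)$. Then: * $T_2$ is complete,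 that is, it is consistent and for every $L$-sentence $\varphi$ either $T_2\models\varphi$ or $T_2\models\neg\varphi$; * $T_2$ is decidable: the set of Gödel numbers of the $L$-sentences $\varphi$ with $T_2\models\varphi$ is recursive; * $T_2$ has quantifier elimination in $L$: every $L$-formula is equivalent modulo $T_2$ to a quantifier-free $L$-formula in the same free variables; * for every infinite set $I$, $T_2$ axiomatizes the theory of the powerset algebra of $I$ with the finite sets distinguished: if $C_n(s)$ is interpreted as "there are at least $n$ distinct atoms below $s$" and $Fin(s)$ as "$s$ is finite", then an $L$-sentence is true in $Powerset(I)$ if and only if it is a consequence of $T_2$. -/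

import Mathlib

open FirstOrder

/-! First-order theory of infinite atomic Boolean algebras with a distinguished ideal `Fin`. -/

namespace BoolFin

/-- The Boolean function symbols `0, 1, ¬, ∩, ∪`. -/
inductive Func : ℕ → Type
  | bot : Func 0
  | top : Func 0
  | compl : Func 1
  | inf : Func 2
  | sup : Func 2

/-- The unary predicates: `C n` for each `n ≥ 1` ("at least `n` atoms below"), and `fin`. -/
inductive Rel : ℕ → Type
  | C (n : ℕ+) : Rel 1
  | fin : Rel 1

/-- The language `{0, 1, ∩, ∪, ¬} ∪ {C_n : n ≥ 1} ∪ {Fin}`. -/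
abbrev lang : FirstOrder.Language.{0, 0} := ⟨Func, Rel⟩

open FirstOrder.Language

section Formulas

variable {α : Type} {n : ℕ}

instance : Bot (lang.Term α) := ⟨Constants.term (L := lang) Func.bot⟩
instance : Top (lang.Term α) := ⟨Constants.term (L := lang) Func.top⟩
instance : Compl (lang.Term α) := ⟨Functions.apply₁ (L := lang) Func.compl⟩
instance : Min (lang.Term α) := ⟨Functions.apply₂ (L := lang) Func.inf⟩
instance : Max (lang.Term α) := ⟨Functions.apply₂ (L := lang) Func.sup⟩

/-- The formula `C_k(t)`. -/
def cF (k : ℕ+) (t : lang.Term (α ⊕ Fin n)) : lang.BoundedFormula α n :=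
  Relations.boundedFormula₁ (L := lang) (Rel.C k) t

/-- The formula `Fin(t)`. -/
def finF (t : lang.Term (α ⊕ Fin n)) : lang.BoundedFormula α n :=
  Relations.boundedFormula₁ (L := lang) Rel.fin t

/-- The formula `s ≤ t`, that is, `s ∩ t = s`. -/
def leF (s t : lang.Term (α ⊕ Fin n)) : lang.BoundedFormula α n := (s ⊓ t) =' s

/-- The term `t`, regarded in a context with one more bound variable. -/
def up (t : lang.Term (α ⊕ Fin n)) : lang.Term (α ⊕ Fin (n + 1)) :=
  t.relabel (Sum.map id Fin.castSucc)

/-- The formula "`t` is an atom": `t ≠ 0 ∧ ∀ y, y ≤ t → y = 0 ∨ y = t`. -/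
def atomF (t : lang.Term (α ⊕ Fin n)) : lang.BoundedFormula α n :=
  ∼(t =' ⊥) ⊓
    ∀' (leF (&(Fin.last n)) (up t) ⟹ ((&(Fin.last n) =' ⊥) ⊔ (&(Fin.last n) =' up t)))

/-- The formula in one free variable `x` saying that there are at least `k` distinct atoms
below `x`, written without the predicates `C_m`. -/
noncomputable def atLeastAtoms (k : ℕ) : lang.Formula (Fin 1) :=
  BoundedFormula.exs (n := k)
    (BoundedFormula.iInf (fun i : Fin k => atomF (&i) ⊓ leF (&i) (Term.var (Sum.inl 0))) ⊓
      BoundedFormula.iInf (fun p : {p : Fin k × Fin k // p.1 ≠ p.2} => ∼((&p.1.1) =' (&p.1.2))))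

end Formulas

section Axioms

/-- Axioms of Boolean algebras. -/
def booleanAxioms : lang.Theory :=
  { ∀' ∀' ((&0 ⊓ &1) =' (&1 ⊓ &0)),
    ∀' ∀' ((&0 ⊔ &1) =' (&1 ⊔ &0)),
    ∀' ∀' ∀' (((&0 ⊓ &1) ⊓ &2) =' (&0 ⊓ (&1 ⊓ &2))),
    ∀' ∀' ∀' (((&0 ⊔ &1) ⊔ &2) =' (&0 ⊔ (&1 ⊔ &2))),
    ∀' ∀' ((&0 ⊓ (&0 ⊔ &1)) =' &0),
    ∀' ∀' ((&0 ⊔ (&0 ⊓ &1)) =' &0),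
    ∀' ∀' ∀' ((&0 ⊓ (&1 ⊔ &2)) =' ((&0 ⊓ &1) ⊔ (&0 ⊓ &2))),
    ∀' ((&0 ⊓ ⊤) =' &0),
    ∀' ((&0 ⊔ ⊥) =' &0),
    ∀' ((&0 ⊓ (&0)ᶜ) =' ⊥),
    ∀' ((&0 ⊔ (&0)ᶜ) =' ⊤) }

/-- Every nonzero element has an atom below it. -/
def atomicAxiom : lang.Sentence :=
  ∀' (∼(&0 =' ⊥) ⟹ ∃' (atomF (&1) ⊓ leF (&1) (&0)))

/-- The defining axiom of `C_k`: `∀ x, C_k(x) ↔ there are at least k distinct atoms below x`. -/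
noncomputable def cAxiom (k : ℕ+) : lang.Sentence :=
  Formula.iAlls (Fin 1) (Formula.relabel (Sum.inr : Fin 1 → Empty ⊕ Fin 1)
    (BoundedFormula.iff (cF k (Term.var (Sum.inl 0))) (atLeastAtoms k)))

/-- The theory `T₁` of infinite atomic Boolean algebras, with the predicates `C_k`. -/
noncomputable def T₁ : lang.Theory :=
  booleanAxioms ∪ lang.infiniteTheory ∪ {atomicAxiom} ∪ Set.range cAxiom

/-- `Fin` is a proper ideal. -/
def idealAxioms : lang.Theory :=
  { finF ⊥,
    ∀' ∀' (finF (&0) ⊓ finF (&1) ⟹ finF (&0 ⊔ &1)),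
    ∀' ∀' (leF (&1) (&0) ⊓ finF (&0) ⟹ finF (&1)),
    ∼(finF ⊤) }

/-- `∀ x, ♯(x) ≤ k → Fin(x)`, where `♯(x) ≤ k` means `¬ C_{k+1}(x)`. -/
def smallAxiom (k : ℕ) : lang.Sentence :=
  ∀' (∼(cF k.succPNat (&0)) ⟹ finF (&0))

/-- `∀ x, ¬ Fin(x) → ∃ y, y < x ∧ ¬ Fin(y) ∧ ¬ Fin(x - y)`. -/
def mainAxiom : lang.Sentence :=
  ∀' (∼(finF (&0)) ⟹
    ∃' ((leF (&1) (&0) ⊓ ∼(&1 =' &0)) ⊓ ∼(finF (&1)) ⊓ ∼(finF (&0 ⊓ (&1)ᶜ))))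

/-- The theory `T₂`. -/
noncomputable def T₂ : lang.Theory :=
  T₁ ∪ idealAxioms ∪ Set.range smallAxiom ∪ {mainAxiom}

end Axioms

section Powerset

/-- The powerset of `I` as a structure: Boolean operations, `C_k(s)` iff there are at least `k`
distinct atoms of the powerset algebra below `s`, and `Fin(s)` iff `s` is finite. -/
instance powersetStructure (I : Type*) : lang.Structure (Set I) where
  funMap := fun {_} f v => match f, v with
    | Func.bot, _ => ∅
    | Func.top, _ => Set.univ
    | Func.compl, v => (v 0)ᶜ
    | Func.inf, v => v 0 ∩ v 1
    | Func.sup, v => v 0 ∪ v 1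
  RelMap := fun {_} r v => match r, v with
    | Rel.C k, v => ∃ A : Finset (Set I), A.card = k ∧ ∀ a ∈ A, IsAtom a ∧ a ⊆ v 0
    | Rel.fin, v => (v 0).Finite

end Powerset

section Decidability

/-- Gödel numbering of terms whose variables are bound variables. -/
def termCode {n : ℕ} : lang.Term (Empty ⊕ Fin n) → ℕ
  | .var (Sum.inl e) => e.elim
  | .var (Sum.inr i) => Nat.pair 0 i
  | .func Func.bot _ => Nat.pair 1 0
  | .func Func.top _ => Nat.pair 2 0
  | .func Func.compl ts => Nat.pair 3 (termCode (ts 0))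
  | .func Func.inf ts => Nat.pair 4 (Nat.pair (termCode (ts 0)) (termCode (ts 1)))
  | .func Func.sup ts => Nat.pair 5 (Nat.pair (termCode (ts 0)) (termCode (ts 1)))

/-- Gödel numbering of formulas without free variables other than the `n` bound variables in scope;
for `n = 0` these are the sentences. -/
def code : {n : ℕ} → lang.BoundedFormula Empty n → ℕ
  | _, .falsum => Nat.pair 0 0
  | _, .equal s t => Nat.pair 1 (Nat.pair (termCode s) (termCode t))
  | _, .rel (Rel.C k) ts => Nat.pair 2 (Nat.pair k (termCode (ts 0)))
  | _, .rel Rel.fin ts => Nat.pair 3 (termCode (ts 0))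
  | _, .imp φ ψ => Nat.pair 4 (Nat.pair (code φ) (code ψ))
  | _, .all φ => Nat.pair 5 (code φ)

theorem termCode_injective {n : ℕ} : Function.Injective (termCode (n := n)) := by
  intro s
  induction s with
  | var a =>
    intro t h
    rcases a with e | i
    · exact e.elim
    · rcases t with (e | j) | ⟨g, us⟩
      · exact e.elim
      · simpa [termCode, Fin.ext_iff] using h
      · cases g <;> simp [termCode] at h
  | func f ts ih =>
    intro t h
    rcases t with (e | j) | ⟨g, us⟩
    · exact e.elim
    · cases f <;> simp [termCode] at h
    · cases f <;> cases g <;> simp [termCode] at h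
      · congr 1; exact funext fun i => i.elim0
      · congr 1; exact funext fun i => i.elim0
      · congr 1; funext i; fin_cases i; exact ih 0 h
      · congr 1; funext i; fin_cases i
        · exact ih 0 h.1
        · exact ih 1 h.2
      · congr 1; funext i; fin_cases i
        · exact ih 0 h.1
        · exact ih 1 h.2

theorem code_injective {n : ℕ} : Function.Injective (code (n := n)) := by
  intro φ
  induction φ with
  | falsum =>
    intro ψ h
    cases ψ with
    | rel r us => cases r <;> simp [code] at h
    | _ => simp_all [code]
  | equal s t =>
    intro ψ h
    cases ψ with
    | rel r us => cases r <;> simp [code] at h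
    | equal s' t' =>
      simp only [code, Nat.pair_eq_pair, true_and] at h
      rw [termCode_injective h.1, termCode_injective h.2]
    | _ => simp [code] at h
  | rel r ts =>
    intro ψ h
    cases ψ with
    | rel r' us =>
      cases r <;> cases r' <;> simp [code] at h
      · obtain ⟨h1, h2⟩ := h
        subst h1
        congr 1; funext i; fin_cases i; exact termCode_injective h2
      · congr 1; funext i; fin_cases i; exact termCode_injective h
    | _ => cases r <;> simp [code] at h
  | imp φ₁ φ₂ ih₁ ih₂ =>
    intro ψ h
    cases ψ with
    | rel r us => cases r <;> simp [code] at h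
    | imp ψ₁ ψ₂ =>
      simp only [code, Nat.pair_eq_pair, true_and] at h
      rw [ih₁ h.1, ih₂ h.2]
    | _ => simp [code] at h
  | all φ ih =>
    intro ψ h
    cases ψ with
    | rel r us => cases r <;> simp [code] at h
    | all ψ =>
      simp only [code, Nat.pair_eq_pair, true_and] at h
      rw [ih h]
    | _ => simp [code] at h

/-- A theory is decidable if the set of Gödel numbers of its consequences is recursive. -/
def IsDecidable (T : lang.Theory) : Prop :=
  ComputablePred fun m : ℕ => ∃ φ : lang.Sentence, code φ = m ∧ T ⊨ᵇ φ

end Decidability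

/-- `T` has quantifier elimination: modulo `T`, every formula is equivalent to a quantifier-free
formula in the same free variables. -/
def HasQuantifierElimination (T : lang.Theory) : Prop :=
  ∀ (n : ℕ) (φ : lang.Formula (Fin n)),
    ∃ ψ : lang.Formula (Fin n), BoundedFormula.IsQF ψ ∧ T ⊨ᵇ φ.iff ψ

end BoolFin

/-! The proof is a back-and-forth argument with a quantitative bound. In an atomic Boolean algebra a
finite tuple is governed by the cells of the partition it generates. A cell is measured by the
number of its atoms in `ℕ∞` and by membership in `Fin`; both are needed, since in a model of `T₂` an
element of `Fin` may have infinitely many atoms. Two elements are similar at level `m` if they agree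
on `Fin` and their atom counts are equal or both at least `m`.

The key step is `Similar.exists_split`: if `x ⊔ x'` is similar to `b` at level `2 * m`, with `x` and
`x'` disjoint, then `b` splits into parts similar to `x` and `x'` at level `m`. When both parts lie
outside `Fin`, this is the Main Axiom; otherwise one counts atoms. Applied in every cell
(`TupleSimilar.exists_snoc`), it says that one more element costs a factor 2 in the level. Hence
tuples similar at level `level φ`, a number that doubles at each quantifier, agree on `φ`
(`realize_iff_of_tupleSimilar`).

Completeness follows because the empty tuple has the single cell `⊤`, which is outside `Fin` in
every model and so has infinitely many atoms. Consistency comes from the powerset of `ℕ`. As every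
infinite powerset is a model, its theory is the set of consequences of `T₂`. Quantifier elimination
follows because similarity of tuples at a fixed level is tested by finitely many formulas `C_k(t)`
and `Fin(t)`, with `t` a term for a cell.

For decidability it suffices to decide truth in the powerset of `ℕ`. There `Fin` means finite, so a
tuple is described, up to what formulas can see, by a finite list of cell profiles with sizes. A
quantifier then ranges over finitely many refinements of this list, up to similarity at a level
computed from the code, which makes the evaluation `truth` primitive recursive (`truth_primrec`,
`truth_code_iff`). -/

namespace BoolFin
open FirstOrder.Language

/-! ### Semantics of the basic terms and formulas. -/

section Realize

variable {α : Type} {n : ℕ} {M : Type*} [lang.Structure M]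

/-- The predicate `Fin` in a structure. -/
def IsFin (x : M) : Prop := Structure.RelMap (L := lang) Rel.fin ![x]

/-- The set of atoms below an element. -/
def atomsBelow {A : Type*} [BooleanAlgebra A] (x : A) : Set A := {a | IsAtom a ∧ a ≤ x}

/-- A Boolean algebra whose symbols are interpreted in such a way that it is a model of `T₂`. -/
class FinAlgebra (A : Type*) [BooleanAlgebra A] [lang.Structure A] : Prop where
  funMap_bot : ∀ v : Fin 0 → A, Structure.funMap (L := lang) Func.bot v = ⊥
  funMap_top : ∀ v : Fin 0 → A, Structure.funMap (L := lang) Func.top v = ⊤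
  funMap_compl : ∀ v : Fin 1 → A, Structure.funMap (L := lang) Func.compl v = (v 0)ᶜ
  funMap_inf : ∀ v : Fin 2 → A, Structure.funMap (L := lang) Func.inf v = v 0 ⊓ v 1
  funMap_sup : ∀ v : Fin 2 → A, Structure.funMap (L := lang) Func.sup v = v 0 ⊔ v 1
  isAtomic : IsAtomic A
  relMap_C : ∀ (k : ℕ+) (v : Fin 1 → A),
    Structure.RelMap (L := lang) (Rel.C k) v ↔ ((k : ℕ) : ℕ∞) ≤ (atomsBelow (v 0)).encard
  isFin_bot : IsFin (⊥ : A)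
  isFin_sup : ∀ x y : A, IsFin x → IsFin y → IsFin (x ⊔ y)
  isFin_of_le : ∀ x y : A, y ≤ x → IsFin x → IsFin y
  not_isFin_top : ¬ IsFin (⊤ : A)
  isFin_of_encard : ∀ x : A, (atomsBelow x).encard < ⊤ → IsFin x
  exists_split : ∀ x : A, ¬ IsFin x → ∃ y ≤ x, ¬ IsFin y ∧ ¬ IsFin (x ⊓ yᶜ)

theorem realize_bot_term (v : α → M) :
    (⊥ : lang.Term α).realize v = Structure.funMap (L := lang) Func.bot ![] := by
  change Structure.funMap (L := lang) Func.bot _ = _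
  congr 1; exact Subsingleton.elim _ _

theorem realize_top_term (v : α → M) :
    (⊤ : lang.Term α).realize v = Structure.funMap (L := lang) Func.top ![] := by
  change Structure.funMap (L := lang) Func.top _ = _
  congr 1; exact Subsingleton.elim _ _

theorem realize_compl_term (v : α → M) (t : lang.Term α) :
    (tᶜ).realize v = Structure.funMap (L := lang) Func.compl ![t.realize v] :=
  Term.realize_functions_apply₁

theorem realize_inf_term (v : α → M) (s t : lang.Term α) :
    (s ⊓ t).realize v = Structure.funMap (L := lang) Func.inf ![s.realize v, t.realize v] :=
  Term.realize_functions_apply₂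

theorem realize_sup_term (v : α → M) (s t : lang.Term α) :
    (s ⊔ t).realize v = Structure.funMap (L := lang) Func.sup ![s.realize v, t.realize v] :=
  Term.realize_functions_apply₂

theorem realize_up (t : lang.Term (α ⊕ Fin n)) (v : α → M) (xs : Fin n → M) (x : M) :
    (up t).realize (Sum.elim v (Fin.snoc xs x)) = t.realize (Sum.elim v xs) := by
  simp [up, Term.realize_relabel, Function.comp_def, Sum.elim_map]

theorem realize_cF (k : ℕ+) (t : lang.Term (α ⊕ Fin n)) (v : α → M) (xs : Fin n → M) :
    (cF k t).Realize v xs ↔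
      Structure.RelMap (L := lang) (Rel.C k) ![t.realize (Sum.elim v xs)] :=
  BoundedFormula.realize_rel₁

theorem realize_finF (t : lang.Term (α ⊕ Fin n)) (v : α → M) (xs : Fin n → M) :
    (finF t).Realize v xs ↔ IsFin (t.realize (Sum.elim v xs)) :=
  BoundedFormula.realize_rel₁

end Realize

section FinAlgebraRealize

variable {α : Type} {n : ℕ} {A : Type*} [BooleanAlgebra A] [lang.Structure A] [FinAlgebra A]

@[simp] theorem realize_top (v : α → A) : (⊤ : lang.Term α).realize v = ⊤ := by
  rw [realize_top_term, FinAlgebra.funMap_top]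

@[simp] theorem realize_compl (v : α → A) (t : lang.Term α) :
    (tᶜ).realize v = (t.realize v)ᶜ := by
  rw [realize_compl_term, FinAlgebra.funMap_compl]; rfl

@[simp] theorem realize_inf (v : α → A) (s t : lang.Term α) :
    (s ⊓ t).realize v = s.realize v ⊓ t.realize v := by
  rw [realize_inf_term, FinAlgebra.funMap_inf]; rfl

end FinAlgebraRealize

section Models

variable {M : Type*} [lang.Structure M]

theorem realize_leF {A : Type*} [BooleanAlgebra A] [lang.Structure A]
    (hinf : ∀ v : Fin 2 → A, Structure.funMap (L := lang) Func.inf v = v 0 ⊓ v 1)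
    {α : Type} {n : ℕ} (s t : lang.Term (α ⊕ Fin n)) (v : α → A) (xs : Fin n → A) :
    (leF s t).Realize v xs ↔ s.realize (Sum.elim v xs) ≤ t.realize (Sum.elim v xs) := by
  rw [leF, BoundedFormula.realize_bdEqual, realize_inf_term, hinf]
  exact inf_eq_left

theorem realize_atomF {A : Type*} [BooleanAlgebra A] [lang.Structure A]
    (hbot : ∀ v : Fin 0 → A, Structure.funMap (L := lang) Func.bot v = ⊥)
    (hinf : ∀ v : Fin 2 → A, Structure.funMap (L := lang) Func.inf v = v 0 ⊓ v 1)
    {α : Type} {n : ℕ} (t : lang.Term (α ⊕ Fin n)) (v : α → A) (xs : Fin n → A) :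
    (atomF t).Realize v xs ↔ IsAtom (t.realize (Sum.elim v xs)) := by
  simp only [atomF, BoundedFormula.realize_inf, BoundedFormula.realize_not,
    BoundedFormula.realize_bdEqual, realize_bot_term, hbot, BoundedFormula.realize_all,
    BoundedFormula.realize_imp, BoundedFormula.realize_sup, realize_leF hinf, realize_up]
  simp only [Function.comp_apply, Term.realize_var, Sum.elim_inr, Fin.snoc_last]
  constructor
  · rintro ⟨h0, h⟩
    exact ⟨h0, fun b hb => (h b hb.le).resolve_right hb.ne⟩
  · intro h
    exact ⟨h.1, fun b hb => h.le_iff.1 hb⟩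

theorem natCast_le_encard_iff {β : Type*} (s : Set β) (k : ℕ) :
    (k : ℕ∞) ≤ s.encard ↔ ∃ f : Fin k → β, (∀ i, f i ∈ s) ∧ ∀ i j, i ≠ j → f i ≠ f j := by
  constructor
  · intro h
    obtain ⟨t, hts, ht⟩ := Set.exists_subset_encard_eq h
    have hfin : t.Finite := Set.finite_of_encard_eq_coe ht
    have hcard : hfin.toFinset.card = k := by
      rw [hfin.encard_eq_coe_toFinset_card] at ht; exact_mod_cast ht
    let e := hfin.toFinset.equivFinOfCardEq hcard
    refine ⟨fun i => e.symm i, fun i => hts (hfin.mem_toFinset.1 (e.symm i).2), fun i j hij h => ?_⟩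
    exact hij (e.symm.injective (Subtype.ext h))
  · rintro ⟨f, hf, hinj⟩
    have hi : Function.Injective f := fun i j h => by
      by_contra hij; exact hinj i j hij h
    calc (k : ℕ∞) = (Set.range f).encard := by
          rw [← Set.image_univ, hi.encard_image]; simp
      _ ≤ _ := Set.encard_le_encard (by rintro _ ⟨i, rfl⟩; exact hf i)

theorem realize_atLeastAtoms {A : Type*} [BooleanAlgebra A] [lang.Structure A]
    (hbot : ∀ v : Fin 0 → A, Structure.funMap (L := lang) Func.bot v = ⊥)
    (hinf : ∀ v : Fin 2 → A, Structure.funMap (L := lang) Func.inf v = v 0 ⊓ v 1)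
    (k : ℕ) (v : Fin 1 → A) :
    (atLeastAtoms k).Realize v ↔ (k : ℕ∞) ≤ (atomsBelow (v 0)).encard := by
  rw [atLeastAtoms, BoundedFormula.realize_exs, natCast_le_encard_iff]
  simp only [BoundedFormula.realize_inf, BoundedFormula.realize_iInf, realize_leF hinf,
    realize_atomF hbot hinf, BoundedFormula.realize_not, BoundedFormula.realize_bdEqual,
    Term.realize_var, Sum.elim_inl, Subtype.forall, Prod.forall, atomsBelow,
    Set.mem_ofPred_eq]
  exact Iff.rfl

theorem realize_cAxiom {A : Type*} [BooleanAlgebra A] [lang.Structure A]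
    (hbot : ∀ v : Fin 0 → A, Structure.funMap (L := lang) Func.bot v = ⊥)
    (hinf : ∀ v : Fin 2 → A, Structure.funMap (L := lang) Func.inf v = v 0 ⊓ v 1) (k : ℕ+) :
    A ⊨ cAxiom k ↔ ∀ v : Fin 1 → A, Structure.RelMap (L := lang) (Rel.C k) v ↔
      ((k : ℕ) : ℕ∞) ≤ (atomsBelow (v 0)).encard := by
  rw [cAxiom, Sentence.Realize, Formula.realize_iAlls]
  refine forall_congr' fun v => ?_
  rw [Formula.realize_relabel]
  have : (Sum.elim (default : Empty → A) v) ∘ (Sum.inr : Fin 1 → Empty ⊕ Fin 1) = v := by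
    funext i; rfl
  rw [show (fun a ↦ Sum.elim default v a) = Sum.elim (default : Empty → A) v from rfl, this,
    Formula.Realize, BoundedFormula.realize_iff, realize_cF]
  have h2 := realize_atLeastAtoms hbot hinf k v
  rw [Formula.Realize] at h2
  rw [h2]
  have : (![(Term.var (Sum.inl 0) : lang.Term (Fin 1 ⊕ Fin 0)).realize
    (Sum.elim v (default : Fin 0 → A))]) = v := by
    funext i; fin_cases i; rfl
  rw [this]

end Models
-- Models of the theory as Boolean algebras; powersets as models.
section Models

/-- The Boolean algebra structure on a model of the axioms of Boolean algebras. -/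
theorem exists_booleanAlgebra {M : Type*} [lang.Structure M] (h : M ⊨ booleanAxioms) :
    ∃ _ : BooleanAlgebra M,
      (∀ v : Fin 0 → M, Structure.funMap (L := lang) Func.bot v = ⊥) ∧
      (∀ v : Fin 0 → M, Structure.funMap (L := lang) Func.top v = ⊤) ∧
      (∀ v : Fin 1 → M, Structure.funMap (L := lang) Func.compl v = (v 0)ᶜ) ∧
      (∀ v : Fin 2 → M, Structure.funMap (L := lang) Func.inf v = v 0 ⊓ v 1) ∧
      (∀ v : Fin 2 → M, Structure.funMap (L := lang) Func.sup v = v 0 ⊔ v 1) := by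
  rw [Theory.model_iff] at h
  simp only [booleanAxioms, Set.mem_insert_iff, Set.mem_singleton_iff, forall_eq_or_imp,
    forall_eq, Sentence.Realize, Formula.Realize, BoundedFormula.realize_all,
    BoundedFormula.realize_bdEqual, realize_bot_term, realize_top_term, realize_compl_term,
    realize_inf_term, realize_sup_term, Function.comp_apply, Term.realize_var, Sum.elim_inr] at h
  simp [Fin.snoc] at h
  obtain ⟨inf_comm, sup_comm, inf_assoc, sup_assoc, inf_sup_self, sup_inf_self, inf_sup,
    inf_top, sup_bot, inf_compl, sup_compl⟩ := h
  let _ : Max M := ⟨fun a b => Structure.funMap (L := lang) Func.sup ![a, b]⟩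
  let _ : Min M := ⟨fun a b => Structure.funMap (L := lang) Func.inf ![a, b]⟩
  let lat : Lattice M :=
    Lattice.mk' sup_comm sup_assoc inf_comm inf_assoc sup_inf_self inf_sup_self
  let dist : DistribLattice M := DistribLattice.ofInfSupLe fun a b c => (inf_sup a b c).le
  let ba : BooleanAlgebra M :=
    { dist with
      compl := fun a => Structure.funMap (L := lang) Func.compl ![a]
      top := Structure.funMap (L := lang) Func.top ![]
      bot := Structure.funMap (L := lang) Func.bot ![]
      inf_compl_le_bot := fun a => (inf_compl a).le
      top_le_sup_compl := fun a => (sup_compl a).ge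
      le_top := fun a => inf_eq_left.1 (inf_top a)
      bot_le := fun a => sup_eq_left.1 (sup_bot a) }
  refine ⟨ba, fun v => ?_, fun v => ?_, fun v => ?_, fun v => ?_, fun v => ?_⟩
  · rw [show v = ![] from Subsingleton.elim _ _]; rfl
  · rw [show v = ![] from Subsingleton.elim _ _]; rfl
  · rw [show v = ![v 0] by funext i; fin_cases i; rfl]; rfl
  · rw [show v = ![v 0, v 1] by funext i; fin_cases i <;> rfl]; rfl
  · rw [show v = ![v 0, v 1] by funext i; fin_cases i <;> rfl]; rfl

theorem models_T₂_iff {A : Type*} [BooleanAlgebra A] [lang.Structure A]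
    (hbot : ∀ v : Fin 0 → A, Structure.funMap (L := lang) Func.bot v = ⊥)
    (htop : ∀ v : Fin 0 → A, Structure.funMap (L := lang) Func.top v = ⊤)
    (hcompl : ∀ v : Fin 1 → A, Structure.funMap (L := lang) Func.compl v = (v 0)ᶜ)
    (hinf : ∀ v : Fin 2 → A, Structure.funMap (L := lang) Func.inf v = v 0 ⊓ v 1)
    (hsup : ∀ v : Fin 2 → A, Structure.funMap (L := lang) Func.sup v = v 0 ⊔ v 1) :
    A ⊨ T₂ ↔ FinAlgebra A := by
  have hB : A ⊨ booleanAxioms := by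
    simp only [Theory.model_iff, booleanAxioms, Set.mem_insert_iff, Set.mem_singleton_iff,
      forall_eq_or_imp,
      forall_eq, Sentence.Realize, Formula.Realize, BoundedFormula.realize_all,
      BoundedFormula.realize_bdEqual, realize_bot_term, realize_top_term, realize_compl_term,
      realize_inf_term, realize_sup_term, Function.comp_apply, Term.realize_var, Sum.elim_inr,
      hbot, htop, hcompl, hinf, hsup]
    simp [Fin.snoc]
    exact ⟨inf_comm, sup_comm, inf_assoc, sup_assoc, inf_sup_left⟩
  have hA : A ⊨ atomicAxiom ↔ ∀ x : A, x ≠ ⊥ → ∃ y, IsAtom y ∧ y ≤ x := by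
    simp only [atomicAxiom, Sentence.Realize, Formula.Realize, BoundedFormula.realize_all,
      BoundedFormula.realize_bdEqual, realize_bot_term, Function.comp_apply, Term.realize_var,
      Sum.elim_inr, BoundedFormula.realize_ex, BoundedFormula.realize_imp,
      BoundedFormula.realize_inf, BoundedFormula.realize_not, realize_leF hinf,
      realize_atomF hbot hinf, hbot]
    simp [Fin.snoc]
  have hM : A ⊨ mainAxiom ↔ ∀ x : A, ¬ IsFin x →
      ∃ y, ((y ≤ x ∧ y ≠ x) ∧ ¬ IsFin y) ∧ ¬ IsFin (x ⊓ yᶜ) := by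
    simp only [mainAxiom, Sentence.Realize, Formula.Realize, BoundedFormula.realize_all,
      BoundedFormula.realize_bdEqual, realize_compl_term, realize_inf_term, Function.comp_apply,
      Term.realize_var, Sum.elim_inr, BoundedFormula.realize_ex, BoundedFormula.realize_imp,
      BoundedFormula.realize_inf, BoundedFormula.realize_not, realize_leF hinf, realize_finF,
      hinf, hcompl]
    simp [Fin.snoc]
  have hS (k : ℕ) : A ⊨ smallAxiom k ↔ ∀ x : A,
      ¬ Structure.RelMap (L := lang) (Rel.C k.succPNat) ![x] → IsFin x := by
    simp only [smallAxiom, Sentence.Realize, Formula.Realize, BoundedFormula.realize_all,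
      Function.comp_apply, Term.realize_var, Sum.elim_inr, BoundedFormula.realize_imp,
      BoundedFormula.realize_not, realize_finF, realize_cF]
    simp [Fin.snoc]
  have hI : A ⊨ idealAxioms ↔ IsFin (⊥ : A) ∧ (∀ x y : A, IsFin x → IsFin y → IsFin (x ⊔ y)) ∧
      (∀ x y : A, y ≤ x → IsFin x → IsFin y) ∧ ¬ IsFin (⊤ : A) := by
    simp only [Theory.model_iff, idealAxioms, Set.mem_insert_iff, Set.mem_singleton_iff,
      forall_eq_or_imp, forall_eq, Sentence.Realize, Formula.Realize, BoundedFormula.realize_all,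
      realize_sup_term, realize_top_term, realize_bot_term, Function.comp_apply,
      Term.realize_var, Sum.elim_inr, BoundedFormula.realize_imp,
      BoundedFormula.realize_inf, BoundedFormula.realize_not, realize_leF hinf, realize_finF,
      hsup, hbot, htop]
    simp [Fin.snoc]
  have hR : ∀ f : ℕ+ → lang.Sentence, A ⊨ Set.range f ↔ ∀ k, A ⊨ f k := fun f => by
    rw [Theory.model_iff, Set.forall_mem_range]
  have hR' : ∀ f : ℕ → lang.Sentence, A ⊨ Set.range f ↔ ∀ k, A ⊨ f k := fun f => by
    rw [Theory.model_iff, Set.forall_mem_range]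
  rw [T₂, T₁, Theory.model_union_iff, Theory.model_union_iff, Theory.model_union_iff,
    Theory.model_union_iff, Theory.model_union_iff, Theory.model_union_iff,
    Theory.model_singleton_iff, Theory.model_singleton_iff, hR, hR', hI, hA, hM,
    model_infiniteTheory_iff]
  simp only [hS, realize_cAxiom hbot hinf]
  constructor
  · rintro ⟨⟨⟨⟨⟨⟨-, -⟩, hat⟩, hC⟩, hi⟩, hs⟩, hm⟩
    refine ⟨hbot, htop, hcompl, hinf, hsup, ⟨fun b => ?_⟩, hC, hi.1, hi.2.1, hi.2.2.1, hi.2.2.2,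
      fun x hx => ?_, fun x hx => ?_⟩
    · exact or_iff_not_imp_left.2 (hat b)
    · obtain ⟨n, hn⟩ := ENat.ne_top_iff_exists.1 hx.ne
      refine hs n x ?_
      rw [hC, not_le]
      change (atomsBelow x).encard < _
      rw [← hn]
      exact_mod_cast Nat.lt_succ_self n
    · obtain ⟨y, ⟨⟨h1, -⟩, h2⟩, h3⟩ := hm x hx
      exact ⟨y, h1, h2, h3⟩
  · intro h
    -- Infinity of the algebra is not a clause of `FinAlgebra`: it follows because `⊤` is outside
    -- `Fin` and so has infinitely many atoms.
    have htopN : (atomsBelow (⊤ : A)).encard = ⊤ := by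
      by_contra hne
      exact h.not_isFin_top (h.isFin_of_encard _ (lt_top_iff_ne_top.2 hne))
    refine ⟨⟨⟨⟨⟨⟨hB, ?_⟩, ?_⟩, h.relMap_C⟩, h.isFin_bot, h.isFin_sup, h.isFin_of_le,
      h.not_isFin_top⟩, fun k x hx => ?_⟩, fun x hx => ?_⟩
    · exact Set.infinite_univ_iff.1 ((Set.encard_eq_top_iff.1 htopN).mono (Set.subset_univ _))
    · intro x hx
      have := h.isAtomic
      exact (eq_bot_or_exists_atom_le x).resolve_left hx
    · refine h.isFin_of_encard x ?_
      rw [h.relMap_C, not_le] at hx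
      exact hx.trans_le le_top
    · obtain ⟨y, h1, h2, h3⟩ := h.exists_split x hx
      refine ⟨y, ⟨⟨h1, ?_⟩, h2⟩, h3⟩
      -- Strictness `y ≠ x` is automatic: for `y = x` the difference is `⊥`, which lies in `Fin`.
      rintro rfl
      rw [inf_compl_self] at h3
      exact h3 h.isFin_bot

theorem exists_finAlgebra (M : Type*) [lang.Structure M] [h : M ⊨ T₂] :
    ∃ _ : BooleanAlgebra M, FinAlgebra M := by
  have hB : M ⊨ booleanAxioms := h.mono fun φ hφ => by
    simp only [T₂, T₁, Set.mem_union]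
    tauto
  obtain ⟨ba, h1, h2, h3, h4, h5⟩ := exists_booleanAlgebra hB
  exact ⟨ba, (models_T₂_iff h1 h2 h3 h4 h5).1 h⟩

theorem encard_atomsBelow_set {I : Type*} (s : Set I) : (atomsBelow s).encard = s.encard := by
  have : atomsBelow s = (fun i => ({i} : Set I)) '' s := by
    ext a
    simp only [atomsBelow, Set.isAtom_iff, Set.mem_ofPred_eq, Set.mem_image]
    constructor
    · rintro ⟨⟨i, rfl⟩, h⟩
      exact ⟨i, by simpa using h, rfl⟩
    · rintro ⟨i, hi, rfl⟩
      exact ⟨⟨i, rfl⟩, by simpa using hi⟩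
  rw [this, Set.singleton_injective.encard_image]

theorem isFin_set {I : Type*} (s : Set I) : IsFin s ↔ s.Finite := Iff.rfl

/-- An infinite set is a disjoint union of two equinumerous parts, and these cannot both be finite.
This gives the Main Axiom in powersets and later splits the infinite cells in the decision
procedure. -/
theorem exists_infinite_split {I : Type*} {s : Set I} (hs : s.Infinite) :
    ∃ t ⊆ s, t.Infinite ∧ (s \ t).Infinite := by
  obtain ⟨t, u, rfl, hd, hc⟩ := hs.exists_union_disjoint_cardinal_eq_of_infinite
  have htu : ((t ∪ u) \ t) = u := by
    rw [Set.union_sdiff_left, hd.symm.sdiff_eq_left]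
  obtain ⟨e⟩ := Cardinal.eq.1 hc
  have hfin : t.Finite ↔ u.Finite := e.finite_iff
  rw [Set.infinite_union] at hs
  refine ⟨t, Set.subset_union_left, ?_, ?_⟩
  · exact hs.elim id fun h => fun h' => h (hfin.1 h')
  · rw [htu]
    exact hs.elim (fun h => fun h' => h (hfin.2 h')) id

instance powerset_finAlgebra (I : Type*) [Infinite I] : FinAlgebra (Set I) where
  funMap_bot _ := rfl
  funMap_top _ := rfl
  funMap_compl _ := rfl
  funMap_inf _ := rfl
  funMap_sup _ := rfl
  isAtomic := inferInstance
  relMap_C k v := by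
    change (∃ A : Finset (Set I), A.card = k ∧ ∀ a ∈ A, IsAtom a ∧ a ⊆ v 0) ↔ _
    constructor
    · rintro ⟨A, hA, h⟩
      rw [← hA, ← Set.encard_coe_eq_coe_finsetCard]
      exact Set.encard_le_encard fun a ha => h a ha
    · intro h
      obtain ⟨t, hts, ht⟩ := Set.exists_subset_encard_eq h
      have hfin : t.Finite := Set.finite_of_encard_eq_coe ht
      refine ⟨hfin.toFinset, ?_, fun a ha => hts (hfin.mem_toFinset.1 ha)⟩
      rw [hfin.encard_eq_coe_toFinset_card] at ht
      exact_mod_cast ht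
  isFin_bot := Set.finite_empty
  isFin_sup _ _ hx hy := Set.Finite.union hx hy
  isFin_of_le _ _ h hx := Set.Finite.subset hx h
  not_isFin_top := Set.infinite_univ
  isFin_of_encard x hx := by
    rw [encard_atomsBelow_set] at hx
    exact Set.encard_lt_top_iff.1 hx
  exists_split x hx := by
    obtain ⟨t, h1, h2, h3⟩ := exists_infinite_split (s := x) hx
    exact ⟨t, h1, h2, h3⟩

theorem powerset_models_T₂ (I : Type*) [Infinite I] : Set I ⊨ T₂ :=
  (models_T₂_iff (fun _ => rfl) (fun _ => rfl) (fun _ => rfl) (fun _ => rfl) fun _ => rfl).2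
    (powerset_finAlgebra I)

end Models
-- Counting atoms.
section Size

variable {A : Type*} [BooleanAlgebra A] [lang.Structure A] [FinAlgebra A]

/-- The number of atoms below an element. -/
noncomputable def size {A : Type*} [BooleanAlgebra A] (x : A) : ℕ∞ := (atomsBelow x).encard

instance (priority := 50) FinAlgebra.toIsAtomic : IsAtomic A := FinAlgebra.isAtomic

theorem atom_le_sup_iff {A : Type*} [BooleanAlgebra A] {p x y : A} (hp : IsAtom p) :
    p ≤ x ⊔ y ↔ p ≤ x ∨ p ≤ y := by
  constructor
  · intro h
    by_contra! hne
    rw [hp.not_le_iff_disjoint, hp.not_le_iff_disjoint] at hne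
    exact hp.ne_bot ((hne.1.sup_right hne.2).eq_bot_of_le h)
  · rintro (h | h)
    exacts [le_sup_of_le_left h, le_sup_of_le_right h]

theorem atom_le_compl_iff {A : Type*} [BooleanAlgebra A] {p x : A} (hp : IsAtom p) :
    p ≤ xᶜ ↔ ¬ p ≤ x := by
  rw [hp.not_le_iff_disjoint, le_compl_iff_disjoint_right]

theorem atom_le_finsetSup_iff {A ι : Type*} [BooleanAlgebra A] {p : A} (hp : IsAtom p)
    (s : Finset ι) (f : ι → A) : p ≤ s.sup f ↔ ∃ i ∈ s, p ≤ f i := by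
  classical
  induction s using Finset.induction_on with
  | empty => simp [hp.ne_bot]
  | insert a s _ ih => simp [atom_le_sup_iff hp, ih]

theorem size_sup {A : Type*} [BooleanAlgebra A] {x y : A} (h : Disjoint x y) :
    size (x ⊔ y) = size x + size y := by
  have hu : atomsBelow (x ⊔ y) = atomsBelow x ∪ atomsBelow y := by
    ext p
    simp only [atomsBelow, Set.mem_ofPred_eq, Set.mem_union, ← and_or_left]
    exact and_congr_right fun hp => atom_le_sup_iff hp
  have hd : Disjoint (atomsBelow x) (atomsBelow y) :=
    Set.disjoint_left.2 fun p hx hy => hx.1.ne_bot (le_bot_iff.1 (h hx.2 hy.2))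
  rw [size, hu, Set.encard_union_eq hd, size, size]

theorem size_eq_zero (x : A) : size x = 0 ↔ x = ⊥ := by
  rw [size, Set.encard_eq_zero]
  constructor
  · intro h
    refine (eq_bot_or_exists_atom_le x).resolve_right ?_
    rintro ⟨a, ha, hle⟩
    exact (h ▸ (show a ∈ atomsBelow x from ⟨ha, hle⟩) : a ∈ (∅ : Set A))
  · rintro rfl
    exact Set.eq_empty_of_forall_notMem fun a ha => ha.1.ne_bot (le_bot_iff.1 ha.2)

theorem size_eq_top {x : A} (h : ¬ IsFin x) : size x = ⊤ := by
  by_contra hne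
  exact h (FinAlgebra.isFin_of_encard x (lt_top_iff_ne_top.2 hne))

theorem isFin_of_size_eq {x : A} {n : ℕ} (h : size x = n) : IsFin x :=
  FinAlgebra.isFin_of_encard x (by rw [← size, h]; exact ENat.natCast_lt_top n)

theorem isFin_sup_iff (x y : A) : IsFin (x ⊔ y) ↔ IsFin x ∧ IsFin y :=
  ⟨fun h => ⟨FinAlgebra.isFin_of_le _ _ le_sup_left h, FinAlgebra.isFin_of_le _ _ le_sup_right h⟩,
    fun h => FinAlgebra.isFin_sup _ _ h.1 h.2⟩

/-- Take the join of `n` atoms below `x`: an atom below a finite join of atoms is one of them. -/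
theorem exists_le_size_eq {A : Type*} [BooleanAlgebra A] (x : A) (n : ℕ)
    (h : (n : ℕ∞) ≤ size x) : ∃ y ≤ x, size y = n := by
  obtain ⟨t, hts, ht⟩ := Set.exists_subset_encard_eq h
  have hfin : t.Finite := Set.finite_of_encard_eq_coe ht
  refine ⟨hfin.toFinset.sup id, Finset.sup_le fun a ha => (hts (hfin.mem_toFinset.1 ha)).2, ?_⟩
  rw [← ht, size]
  congr 1
  ext p
  constructor
  · rintro ⟨hp, hle⟩
    obtain ⟨a, ha, hpa⟩ := (atom_le_finsetSup_iff hp _ _).1 hle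
    rw [hfin.mem_toFinset] at ha
    rcases (hts ha).1.le_iff.1 hpa with h0 | rfl
    · exact (hp.ne_bot h0).elim
    · exact ha
  · intro hp
    exact ⟨(hts hp).1, Finset.le_sup (f := id) (hfin.mem_toFinset.2 hp)⟩

end Size

/-! ### Similarity of elements and the splitting lemma. -/

section Similar

/-- `x` and `y` cannot be distinguished by the predicates `C_k` with `k ≤ m` and `Fin`. -/
def Similar {A B : Type*} [BooleanAlgebra A] [lang.Structure A] [BooleanAlgebra B]
    [lang.Structure B] (m : ℕ) (x : A) (y : B) : Prop :=
  (size x = size y ∨ ((m : ℕ∞) ≤ size x ∧ (m : ℕ∞) ≤ size y)) ∧ (IsFin x ↔ IsFin y)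

variable {A B : Type*} [BooleanAlgebra A] [lang.Structure A]
  [BooleanAlgebra B] [lang.Structure B] {m : ℕ}

theorem Similar.symm {x : A} {y : B} (h : Similar m x y) : Similar m y x :=
  ⟨h.1.imp Eq.symm And.symm, h.2.symm⟩

theorem Similar.mono {k : ℕ} {x : A} {y : B} (h : Similar m x y) (hk : k ≤ m) : Similar k x y := by
  have hk : (k : ℕ∞) ≤ m := by exact_mod_cast hk
  exact ⟨h.1.imp_right fun h => ⟨hk.trans h.1, hk.trans h.2⟩, h.2⟩

theorem similar_natCast_le_size {k : ℕ} {x : A} {y : B} (h : Similar m x y) (hk : k ≤ m) :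
    (k : ℕ∞) ≤ size x ↔ (k : ℕ∞) ≤ size y := by
  rcases h.1 with h | h
  · rw [h]
  · have hk : (k : ℕ∞) ≤ m := by exact_mod_cast hk
    exact iff_of_true (hk.trans h.1) (hk.trans h.2)

variable [FinAlgebra A] [FinAlgebra B]

theorem Similar.sup {x x' : A} {y y' : B} (h : Similar m x y) (h' : Similar m x' y')
    (hx : Disjoint x x') (hy : Disjoint y y') : Similar m (x ⊔ x') (y ⊔ y') := by
  refine ⟨?_, by rw [isFin_sup_iff, isFin_sup_iff, h.2, h'.2]⟩
  rw [size_sup hx, size_sup hy]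
  rcases h.1 with h | h
  · rcases h'.1 with h' | h'
    · exact Or.inl (by rw [h, h'])
    · exact Or.inr ⟨h'.1.trans le_add_self, h'.2.trans le_add_self⟩
  · exact Or.inr ⟨h.1.trans le_self_add, h.2.trans le_self_add⟩

theorem similar_bot_iff {x : A} {y : B} (h : Similar m x y)
    (hm : 1 ≤ m) : x = ⊥ ↔ y = ⊥ := by
  rw [← size_eq_zero, ← size_eq_zero]
  rcases h.1 with h | h
  · rw [h]
  · have hm : (1 : ℕ∞) ≤ m := by exact_mod_cast hm
    have h1 := hm.trans h.1
    have h2 := hm.trans h.2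
    constructor <;> intro h0 <;> simp_all

/-- The part matching `x` can be chosen with finitely many atoms, even if `x` has infinitely many.
The last hypothesis excludes the case where `x` is large and `x'` small, in which the small part has
to be matched first. -/
theorem Similar.exists_split_of_isFin {x x' : A} {b : B} (hx : Disjoint x x')
    (h : Similar (2 * m) (x ⊔ x') b) (hfin : IsFin x)
    (hsize : size x < m ∨ (m : ℕ∞) ≤ size x') :
    ∃ y y', Disjoint y y' ∧ y ⊔ y' = b ∧ Similar m x y ∧ Similar m x' y' := by
  -- Here `n` is the number of atoms for the part matching `x`: the size of `x` if that is below
  -- `m`, and `m` otherwise. The remaining size `q` is quantified because subtraction in `ℕ∞` is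
  -- awkward when `b` is infinite.
  have key : ∃ n : ℕ, (n : ℕ∞) ≤ size b ∧ ∀ q : ℕ∞, n + q = size b →
      (size x = n ∨ ((m : ℕ∞) ≤ size x ∧ (m : ℕ∞) ≤ n)) ∧
      (size x' = q ∨ ((m : ℕ∞) ≤ size x' ∧ (m : ℕ∞) ≤ q)) := by
    obtain ⟨h, -⟩ := h
    rw [size_sup hx] at h
    generalize size x = p at *
    generalize size x' = p' at *
    generalize size b = s at *
    by_cases hp : p < m
    · obtain ⟨n, rfl⟩ := ENat.ne_top_iff_exists.1 hp.ne_top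
      refine ⟨n, ?_, fun q hq => ⟨Or.inl rfl, ?_⟩⟩
      · rcases h with h | h
        · rw [← h]; exact le_self_add
        · refine le_trans ?_ h.2
          norm_cast at hp ⊢
          omega
      · subst hq
        have hn : n < m := by exact_mod_cast hp
        -- The factor 2 pays for this: removing fewer than `m` atoms from at least `2 * m` leaves at
        -- least `m`.
        have aux : ∀ r : ℕ∞, ((2 * m : ℕ) : ℕ∞) ≤ n + r → (m : ℕ∞) ≤ r := by
          intro r hr
          cases r
          · exact le_top
          · norm_cast at *
            omega
        rcases h with h | h
        · exact Or.inl (WithTop.add_left_cancel hp.ne_top h)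
        · exact Or.inr ⟨aux _ h.1, aux _ h.2⟩
    · have hp' := hsize.resolve_left hp
      push Not at hp
      have h2 : (2 * m : ℕ) ≤ s := by
        rcases h with h | h
        · rw [← h, two_mul]
          push_cast
          exact add_le_add hp hp'
        · exact h.2
      refine ⟨m, le_trans (by norm_cast; omega) h2, fun q hq => ⟨Or.inr ⟨hp, le_rfl⟩,
        Or.inr ⟨hp', ?_⟩⟩⟩
      rw [← hq] at h2
      cases q
      · exact le_top
      · norm_cast at *
        omega
  obtain ⟨n, hn, hq⟩ := key
  obtain ⟨y, hy, hyn⟩ := exists_le_size_eq b n hn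
  have hd : Disjoint y (b ⊓ yᶜ) := disjoint_compl_right.mono_right inf_le_right
  have hs : y ⊔ (b ⊓ yᶜ) = b := by
    rw [sup_inf_left, sup_compl_eq_top, inf_top_eq, sup_eq_right.2 hy]
  -- As `x` and `y` both lie in `Fin`, the complementary parts lie in `Fin` exactly when `x ⊔ x'`
  -- and `b` do.
  have hyfin := isFin_of_size_eq hyn
  have hb := h.2
  rw [← hs, isFin_sup_iff, isFin_sup_iff] at hb
  obtain ⟨h1, h2⟩ := hq (size (b ⊓ yᶜ)) (by rw [← hyn, ← size_sup hd, hs])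
  rw [← hyn] at h1
  exact ⟨y, b ⊓ yᶜ, hd, hs, ⟨h1, by tauto⟩, ⟨h2, by tauto⟩⟩

/-- If atom counting applies neither to `x` nor to `x'`, then both lie outside `Fin`: a part in
`Fin` is either handled directly or is large beside a small part, and the small part is then itself
in `Fin` and can be handled. So `b` is outside `Fin`, the Main Axiom splits it, and all four parts
have infinite size. -/
theorem Similar.exists_split {x x' : A} {b : B} (hx : Disjoint x x')
    (h : Similar (2 * m) (x ⊔ x') b) :
    ∃ y y', Disjoint y y' ∧ y ⊔ y' = b ∧ Similar m x y ∧ Similar m x' y' := by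
  by_cases h1 : IsFin x ∧ (size x < m ∨ (m : ℕ∞) ≤ size x')
  · exact h.exists_split_of_isFin hx h1.1 h1.2
  by_cases h2 : IsFin x' ∧ (size x' < m ∨ (m : ℕ∞) ≤ size x)
  · rw [sup_comm] at h
    obtain ⟨y, y', h3, h4, h5, h6⟩ := h.exists_split_of_isFin hx.symm h2.1 h2.2
    exact ⟨y', y, h3.symm, by rw [sup_comm, h4], h6, h5⟩
  have hnx : ¬ IsFin x := by
    intro hfin
    simp only [hfin, true_and, not_or, not_lt, not_le] at h1
    have : IsFin x' := by
      by_contra hx'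
      rw [size_eq_top hx'] at h1
      exact not_top_lt h1.2
    exact h2 ⟨this, Or.inl h1.2⟩
  have hnx' : ¬ IsFin x' := by
    intro hfin
    exact h2 ⟨hfin, Or.inr (by rw [size_eq_top hnx]; exact le_top)⟩
  have hb : ¬ IsFin b := by
    rw [← h.2, isFin_sup_iff]
    tauto
  obtain ⟨y, hy, hy1, hy2⟩ := FinAlgebra.exists_split b hb
  refine ⟨y, b ⊓ yᶜ, disjoint_compl_right.mono_right inf_le_right, ?_, ⟨Or.inl ?_, ?_⟩,
    ⟨Or.inl ?_, ?_⟩⟩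
  · rw [sup_inf_left, sup_compl_eq_top, inf_top_eq, sup_eq_right.2 hy]
  · rw [size_eq_top hnx, size_eq_top hy1]
  · exact iff_of_false hnx hy1
  · rw [size_eq_top hnx', size_eq_top hy2]
  · exact iff_of_false hnx' hy2

end Similar
-- Cells of the partition generated by a tuple.
section Cells

/-- The value of a term in the two-element Boolean algebra. -/
def evalBool {ι : Type} (w : ι → Bool) : lang.Term ι → Bool
  | .var i => w i
  | .func Func.bot _ => false
  | .func Func.top _ => true
  | .func Func.compl ts => !(evalBool w (ts 0))
  | .func Func.inf ts => evalBool w (ts 0) && evalBool w (ts 1)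
  | .func Func.sup ts => evalBool w (ts 0) || evalBool w (ts 1)

/-- Being above a fixed atom is a homomorphism to the two-element algebra, so terms can be evaluated
atom by atom. -/
theorem atom_le_realize_iff {ι : Type} {A : Type*} [BooleanAlgebra A] [lang.Structure A]
    [FinAlgebra A] {p : A} (hp : IsAtom p) {a : ι → A} {w : ι → Bool}
    (hw : ∀ i, p ≤ a i ↔ w i = true) (t : lang.Term ι) :
    p ≤ t.realize a ↔ evalBool w t = true := by
  induction t with
  | var i => exact hw i
  | func f ts ih =>
    cases f with
    | bot => simp [Term.realize, FinAlgebra.funMap_bot, evalBool, hp.ne_bot]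
    | top => simp [Term.realize, FinAlgebra.funMap_top, evalBool]
    | compl =>
      simp [Term.realize, FinAlgebra.funMap_compl, evalBool, atom_le_compl_iff hp, ih]
    | inf => simp [Term.realize, FinAlgebra.funMap_inf, evalBool, ih]
    | sup => simp [Term.realize, FinAlgebra.funMap_sup, evalBool, atom_le_sup_iff hp, ih]

variable {ι : Type} [Fintype ι]

/-- The cell with profile `w` of the partition generated by a tuple. -/
def cell {A : Type*} [BooleanAlgebra A] (a : ι → A) (w : ι → Bool) : A :=
  Finset.univ.inf fun i => if w i then a i else (a i)ᶜ

theorem atom_le_cell_iff {A : Type*} [BooleanAlgebra A] {p : A} (hp : IsAtom p) (a : ι → A)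
    (w : ι → Bool) : p ≤ cell a w ↔ ∀ i, p ≤ a i ↔ w i = true := by
  rw [cell, Finset.le_inf_iff]
  simp only [Finset.mem_univ, true_imp_iff]
  refine forall_congr' fun i => ?_
  cases w i <;> simp [atom_le_compl_iff hp]

theorem atom_le_cell_profile {A : Type*} [BooleanAlgebra A] {p : A} (hp : IsAtom p)
    (a : ι → A) : ∃ w, p ≤ cell a w := by
  classical
  exact ⟨fun i => decide (p ≤ a i), (atom_le_cell_iff hp a _).2 fun i => by simp⟩

theorem eq_of_atom_le_cell {A : Type*} [BooleanAlgebra A] {p : A} (hp : IsAtom p)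
    {a : ι → A} {w w' : ι → Bool} (h : p ≤ cell a w) (h' : p ≤ cell a w') : w = w' := by
  funext i
  rw [Bool.eq_iff_iff, ← (atom_le_cell_iff hp a w).1 h i, (atom_le_cell_iff hp a w').1 h' i]

variable {A B : Type*} [BooleanAlgebra A] [lang.Structure A] [FinAlgebra A]
  [BooleanAlgebra B] [lang.Structure B] [FinAlgebra B] {m : ℕ}

theorem disjoint_cell (a : ι → A) {w w' : ι → Bool} (h : w ≠ w') :
    Disjoint (cell a w) (cell a w') := by
  rw [disjoint_iff, BooleanAlgebra.eq_iff_atom_le_iff]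
  intro p hp
  rw [le_inf_iff, le_bot_iff]
  exact iff_of_false (fun hh => h (eq_of_atom_le_cell hp hh.1 hh.2)) hp.ne_bot

/-- Disjunctive normal form. The set of profiles depends only on the term, not on the algebra or the
tuple. -/
theorem realize_eq_sup_cell [DecidableEq ι] (a : ι → A) (t : lang.Term ι) :
    t.realize a = (Finset.univ.filter fun w => evalBool w t = true).sup (cell a) := by
  rw [BooleanAlgebra.eq_iff_atom_le_iff]
  intro p hp
  obtain ⟨w, hw⟩ := atom_le_cell_profile hp a
  rw [atom_le_realize_iff hp ((atom_le_cell_iff hp a w).1 hw), atom_le_finsetSup_iff hp]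
  simp only [Finset.mem_filter, Finset.mem_univ, true_and]
  constructor
  · exact fun h => ⟨w, h, hw⟩
  · rintro ⟨w', h, hw'⟩
    rwa [eq_of_atom_le_cell hp hw hw']

theorem realize_eq_realize_iff (a : ι → A) (s t : lang.Term ι) :
    s.realize a = t.realize a ↔ ∀ w, evalBool w s ≠ evalBool w t → cell a w = ⊥ := by
  constructor
  · intro h w hw
    by_contra hne
    obtain ⟨p, hp, hle⟩ := (eq_bot_or_exists_atom_le _).resolve_left hne
    have hprof := (atom_le_cell_iff hp a w).1 hle
    apply hw
    rw [Bool.eq_iff_iff, ← atom_le_realize_iff hp hprof, ← atom_le_realize_iff hp hprof, h]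
  · intro h
    rw [BooleanAlgebra.eq_iff_atom_le_iff]
    intro p hp
    obtain ⟨w, hw⟩ := atom_le_cell_profile hp a
    have hprof := (atom_le_cell_iff hp a w).1 hw
    rw [atom_le_realize_iff hp hprof, atom_le_realize_iff hp hprof]
    by_cases he : evalBool w s = evalBool w t
    · rw [he]
    · rw [h w he] at hw
      exact (hp.ne_bot (le_bot_iff.1 hw)).elim

/-- Two tuples all of whose cells are similar. -/
def TupleSimilar (m : ℕ) (a : ι → A) (b : ι → B) : Prop :=
  ∀ w, Similar m (cell a w) (cell b w)

/-- On both sides the value of the term is the join of the same disjoint cells, and similarity is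
preserved by disjoint joins. -/
theorem TupleSimilar.realize {a : ι → A} {b : ι → B} (h : TupleSimilar m a b)
    (t : lang.Term ι) : Similar m (t.realize a) (t.realize b) := by
  classical
  rw [realize_eq_sup_cell, realize_eq_sup_cell]
  generalize Finset.univ.filter (fun w => evalBool w t = true) = s
  induction s using Finset.induction_on with
  | empty =>
    simp only [Finset.sup_empty]
    refine ⟨Or.inl ?_, iff_of_true FinAlgebra.isFin_bot FinAlgebra.isFin_bot⟩
    rw [(size_eq_zero _).2 rfl, (size_eq_zero _).2 rfl]
  | insert w s hw ih =>
    rw [Finset.sup_insert, Finset.sup_insert]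
    refine (h w).sup ih ?_ ?_
    · exact Finset.disjoint_sup_right.2 fun w' hw' =>
        disjoint_cell a (ne_of_mem_of_not_mem hw' hw).symm
    · exact Finset.disjoint_sup_right.2 fun w' hw' =>
        disjoint_cell b (ne_of_mem_of_not_mem hw' hw).symm

theorem TupleSimilar.realize_eq_iff {a : ι → A} {b : ι → B} (h : TupleSimilar m a b)
    (hm : 1 ≤ m) (s t : lang.Term ι) :
    s.realize a = t.realize a ↔ s.realize b = t.realize b := by
  rw [realize_eq_realize_iff, realize_eq_realize_iff]
  exact forall_congr' fun w => imp_congr_right fun _ => similar_bot_iff (h w) hm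

theorem cell_snoc {α : Type} [Fintype α] {n : ℕ} (v : α → A) (xs : Fin n → A) (x : A)
    (w : α ⊕ Fin (n + 1) → Bool) :
    cell (Sum.elim v (Fin.snoc xs x)) w =
      cell (Sum.elim v xs) (w ∘ Sum.map id Fin.castSucc) ⊓
        (if w (Sum.inr (Fin.last n)) then x else xᶜ) := by
  rw [BooleanAlgebra.eq_iff_atom_le_iff]
  intro p hp
  rw [le_inf_iff, atom_le_cell_iff hp, atom_le_cell_iff hp, Sum.forall, Sum.forall,
    Fin.forall_fin_succ']
  have : p ≤ (if w (Sum.inr (Fin.last n)) then x else xᶜ) ↔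
      (p ≤ x ↔ w (Sum.inr (Fin.last n)) = true) := by
    cases w (Sum.inr (Fin.last n)) <;> simp [atom_le_compl_iff hp]
  rw [this]
  simp [and_assoc]

/-- The element `x` cuts each cell in two; `Similar.exists_split` cuts the corresponding cell on the
other side. The required element is the join of the chosen first parts, and cells being disjoint, it
meets each cell in just the part chosen there. -/
theorem TupleSimilar.exists_snoc {α : Type} [Fintype α] {n : ℕ} {v : α → A} {xs : Fin n → A}
    {v' : α → B} {xs' : Fin n → B}
    (h : TupleSimilar (2 * m) (Sum.elim v xs) (Sum.elim v' xs')) (x : A) :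
    ∃ y, TupleSimilar m (Sum.elim v (Fin.snoc xs x)) (Sum.elim v' (Fin.snoc xs' y)) := by
  classical
  have hsplit : ∀ u, ∃ y y', Disjoint y y' ∧ y ⊔ y' = cell (Sum.elim v' xs') u ∧
      Similar m (cell (Sum.elim v xs) u ⊓ x) y ∧ Similar m (cell (Sum.elim v xs) u ⊓ xᶜ) y' := by
    intro u
    refine Similar.exists_split
      (disjoint_compl_right.mono inf_le_right inf_le_right) ?_
    rw [← inf_sup_left, sup_compl_eq_top, inf_top_eq]
    exact h u
  choose y y' hd hs h1 h2 using hsplit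
  have hy : ∀ u, cell (Sum.elim v' xs') u ⊓ Finset.univ.sup y = y u := by
    intro u
    rw [BooleanAlgebra.eq_iff_atom_le_iff]
    intro p hp
    rw [le_inf_iff, atom_le_finsetSup_iff hp]
    constructor
    · rintro ⟨hu, u', -, hu'⟩
      have : p ≤ cell (Sum.elim v' xs') u' := by rw [← hs]; exact le_sup_of_le_left hu'
      rwa [eq_of_atom_le_cell hp hu this]
    · intro hu
      exact ⟨by rw [← hs]; exact le_sup_of_le_left hu, u, Finset.mem_univ u, hu⟩
  have hy' : ∀ u, cell (Sum.elim v' xs') u ⊓ (Finset.univ.sup y)ᶜ = y' u := by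
    intro u
    have h3 : cell (Sum.elim v' xs') u ⊓ (Finset.univ.sup y)ᶜ =
        cell (Sum.elim v' xs') u ⊓ (cell (Sum.elim v' xs') u ⊓ Finset.univ.sup y)ᶜ := by
      rw [compl_inf, inf_sup_left, inf_compl_self, bot_sup_eq]
    rw [h3, hy, ← hs, inf_sup_right, inf_compl_self, bot_sup_eq, inf_eq_left]
    exact (hd u).symm.le_compl_right
  refine ⟨Finset.univ.sup y, fun w => ?_⟩
  rw [cell_snoc, cell_snoc]
  cases w (Sum.inr (Fin.last n))
  · simp only [Bool.false_eq_true, if_false, hy']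
    exact h2 _
  · simp only [if_true, hy]
    exact h1 _

end Cells

section TupleSimilar

variable {ι : Type} [Fintype ι]

theorem TupleSimilar.symm {A B : Type*} [BooleanAlgebra A] [lang.Structure A]
    [BooleanAlgebra B] [lang.Structure B] {m : ℕ} {a : ι → A} {b : ι → B} (h : TupleSimilar m a b) :
    TupleSimilar m b a := fun w => (h w).symm

theorem TupleSimilar.mono {k : ℕ} {A B : Type*} [BooleanAlgebra A] [lang.Structure A]
    [BooleanAlgebra B] [lang.Structure B] {m : ℕ} {a : ι → A} {b : ι → B} (h : TupleSimilar m a b)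
    (hk : k ≤ m) : TupleSimilar k a b := fun w => (h w).mono hk

end TupleSimilar

/-! ### Similar tuples satisfy the same formulas. -/

section Formulas

variable {α : Type}

/-- Tuples that are similar at level `level φ` agree on `φ`. -/
def level : {n : ℕ} → lang.BoundedFormula α n → ℕ
  | _, .falsum => 1
  | _, .equal _ _ => 1
  | _, .rel (Rel.C k) _ => k
  | _, .rel Rel.fin _ => 1
  | _, .imp φ ψ => max (level φ) (level ψ)
  | _, .all φ => 2 * level φ

theorem relMap_C_iff {A : Type*} [BooleanAlgebra A] [lang.Structure A] [FinAlgebra A] (k : ℕ+)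
    (v : Fin 1 → A) :
    Structure.RelMap (L := lang) (Rel.C k) v ↔ ((k : ℕ) : ℕ∞) ≤ size (v 0) :=
  FinAlgebra.relMap_C k v

theorem relMap_fin_iff {A : Type*} [lang.Structure A] (v : Fin 1 → A) :
    Structure.RelMap (L := lang) Rel.fin v ↔ IsFin (v 0) := by
  rw [IsFin, show v = ![v 0] by funext i; fin_cases i; rfl]
  rfl

/-- Induction on the formula. Level 1 suffices for equations, since it detects empty cells; level
`k` is what `C_k` needs; a quantifier uses up a factor 2 through `TupleSimilar.exists_snoc`, in both
directions. -/
theorem realize_iff_of_tupleSimilar [Fintype α] {A B : Type*}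
    [BooleanAlgebra A] [lang.Structure A] [FinAlgebra A]
    [BooleanAlgebra B] [lang.Structure B] [FinAlgebra B] {n : ℕ} (φ : lang.BoundedFormula α n)
    {m : ℕ} (hm : level φ ≤ m) {v : α → A} {xs : Fin n → A} {v' : α → B} {xs' : Fin n → B}
    (h : TupleSimilar m (Sum.elim v xs) (Sum.elim v' xs')) :
    φ.Realize v xs ↔ φ.Realize v' xs' := by
  replace h := h.mono hm
  clear hm
  induction φ with
  | falsum => exact Iff.rfl
  | equal s t => exact h.realize_eq_iff le_rfl s t
  | rel r ts =>
    cases r with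
    | C k =>
      change Structure.RelMap _ _ ↔ Structure.RelMap _ _
      rw [relMap_C_iff, relMap_C_iff]
      exact similar_natCast_le_size (h.realize (ts 0)) le_rfl
    | fin =>
      change Structure.RelMap _ _ ↔ Structure.RelMap _ _
      rw [relMap_fin_iff, relMap_fin_iff]
      exact (h.realize (ts 0)).2
  | imp φ ψ ih1 ih2 =>
    exact imp_congr (ih1 (h.mono (le_max_left _ _))) (ih2 (h.mono (le_max_right _ _)))
  | all φ ih =>
    rw [BoundedFormula.realize_all, BoundedFormula.realize_all]
    constructor
    · intro hall y
      obtain ⟨x, hx⟩ := h.symm.exists_snoc y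
      exact (ih hx.symm).1 (hall x)
    · intro hall x
      obtain ⟨y, hy⟩ := h.exists_snoc x
      exact (ih hy).2 (hall y)

end Formulas
-- Completeness and the theory of powersets.
section Completeness

/-- The only cell is the empty meet `⊤`, which is outside `Fin` and hence of infinite size in both
algebras. -/
theorem tupleSimilar_of_isEmpty {ι : Type} [Fintype ι] [IsEmpty ι] {A B : Type*}
    [BooleanAlgebra A] [lang.Structure A] [FinAlgebra A]
    [BooleanAlgebra B] [lang.Structure B] [FinAlgebra B] (m : ℕ) (a : ι → A) (b : ι → B) :
    TupleSimilar m a b := by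
  intro w
  have hA : ¬ IsFin (⊤ : A) := FinAlgebra.not_isFin_top
  have hB : ¬ IsFin (⊤ : B) := FinAlgebra.not_isFin_top
  rw [cell, cell, Finset.univ_eq_empty, Finset.inf_empty, Finset.inf_empty]
  exact ⟨Or.inl (by rw [size_eq_top hA, size_eq_top hB]), iff_of_false hA hB⟩

theorem T₂_isComplete : T₂.IsComplete := by
  rw [Theory.IsComplete.isComplete_iff_models_elementarily_equivalent]
  refine ⟨?_, fun M N => ?_⟩
  · have := powerset_models_T₂ ℕ
    exact Theory.Model.isSatisfiable (Set ℕ)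
  · rw [elementarilyEquivalent_iff]
    intro φ
    obtain ⟨_, _⟩ := exists_finAlgebra M
    obtain ⟨_, _⟩ := exists_finAlgebra N
    exact realize_iff_of_tupleSimilar φ le_rfl (tupleSimilar_of_isEmpty (level φ) _ _)

theorem realize_powerset_iff (I : Type*) [Infinite I] (φ : lang.Sentence) :
    Set I ⊨ φ ↔ T₂ ⊨ᵇ φ :=
  have := powerset_models_T₂ I
  T₂_isComplete.realize_sentence_iff φ (Set I)

end Completeness

/-! ### Quantifier elimination. -/

section QuantifierElimination

theorem isQF_iInf {L : FirstOrder.Language} {α : Type*} {n : ℕ} {β : Type*} [Finite β]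
    {f : β → L.BoundedFormula α n} (h : ∀ b, (f b).IsQF) :
    (BoundedFormula.iInf f).IsQF := by
  have : ∀ l : List β, ((l.map f).foldr (· ⊓ ·) ⊤).IsQF := by
    intro l
    induction l with
    | nil => exact BoundedFormula.IsQF.top
    | cons b l ih => exact (h b).inf ih
  exact this _

theorem isQF_iSup {L : FirstOrder.Language} {α : Type*} {n : ℕ} {β : Type*} [Finite β]
    {f : β → L.BoundedFormula α n} (h : ∀ b, (f b).IsQF) :
    (BoundedFormula.iSup f).IsQF := by
  have : ∀ l : List β, ((l.map f).foldr (· ⊔ ·) ⊥).IsQF := by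
    intro l
    induction l with
    | nil => exact BoundedFormula.isQF_bot
    | cons b l ih => exact (h b).sup ih
  exact this _

/-- A formula whose truth value in models of `T` is determined by the truth values of finitely
many quantifier-free formulas is equivalent modulo `T` to a quantifier-free formula. -/
theorem exists_isQF_of_determined {L : FirstOrder.Language.{0, 0}} {T : L.Theory} {α : Type}
    (φ : L.Formula α) {ι : Type*} [Finite ι] (θ : ι → L.Formula α) (hθ : ∀ i, (θ i).IsQF)
    (h : ∀ (M N : Theory.ModelType.{0, 0, 0} T) (v : α → M) (v' : α → N),
      (∀ i, (θ i).Realize v ↔ (θ i).Realize v') → φ.Realize v → φ.Realize v') :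
    ∃ ψ : L.Formula α, BoundedFormula.IsQF ψ ∧ T ⊨ᵇ φ.iff ψ := by
  classical
  -- The truth patterns of the `θ i` that occur together with `φ` in some model. There are finitely
  -- many, so their disjunction is a formula and compactness is not needed.
  let S := {p : Set ι // ∃ (M : Theory.ModelType.{0, 0, 0} T) (v : α → M),
    (∀ i, (θ i).Realize v ↔ i ∈ p) ∧ φ.Realize v}
  let ψ : L.Formula α := BoundedFormula.iSup fun p : S =>
    BoundedFormula.iInf fun i => if i ∈ p.1 then θ i else (θ i).not
  have hψ : ∀ (M : Theory.ModelType.{0, 0, 0} T) (v : α → M),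
      ψ.Realize v ↔ ∃ p : S, ∀ i, (θ i).Realize v ↔ i ∈ p.1 := by
    intro M v
    simp only [ψ, Formula.Realize, BoundedFormula.realize_iSup, BoundedFormula.realize_iInf]
    refine exists_congr fun p => forall_congr' fun i => ?_
    by_cases hi : i ∈ p.1
    · simp [hi]
    · simp only [hi, if_false, iff_false]
      exact Formula.realize_not
  refine ⟨ψ, isQF_iSup fun p => isQF_iInf fun i => ?_, ?_⟩
  · split_ifs
    exacts [hθ i, (hθ i).not]
  · rw [Theory.models_formula_iff]
    intro M v
    rw [Formula.realize_iff, hψ]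
    constructor
    · intro hφ
      exact ⟨⟨{i | (θ i).Realize v}, M, v, fun i => Iff.rfl, hφ⟩, fun i => Iff.rfl⟩
    · rintro ⟨⟨p, N, v', hp, hφ⟩, hv⟩
      exact h N M v' v (fun i => (hp i).trans (hv i).symm) hφ

/-- The term defining the cell with profile `w`. -/
def cellTerm {α : Type} (w : α → Bool) (l : List α) : lang.Term (α ⊕ Fin 0) :=
  l.foldr (fun i t => (if w i then Term.var (Sum.inl i) else (Term.var (Sum.inl i))ᶜ) ⊓ t) ⊤

theorem realize_cellTerm {n : ℕ} {A : Type*} [BooleanAlgebra A]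
    [lang.Structure A] [FinAlgebra A] (w : Fin n → Bool) (v : Fin n → A) (xs : Fin 0 → A) :
    (cellTerm w (List.finRange n)).realize (Sum.elim v xs) = cell v w := by
  rw [BooleanAlgebra.eq_iff_atom_le_iff]
  intro p hp
  have : ∀ l : List (Fin n), p ≤ (cellTerm w l).realize (Sum.elim v xs) ↔
      ∀ i ∈ l, (p ≤ v i ↔ w i = true) := by
    intro l
    induction l with
    | nil => simp [cellTerm]
    | cons i l ih =>
      change p ≤ Term.realize _ ((if w i then Term.var (Sum.inl i) else
        (Term.var (Sum.inl i))ᶜ) ⊓ cellTerm w l) ↔ _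
      rw [realize_inf, le_inf_iff, ih, List.forall_mem_cons]
      cases w i <;> simp [atom_le_compl_iff hp]
  rw [this, atom_le_cell_iff hp]
  simp

theorem eq_or_le_of_forall_succ_le_iff {s s' : ℕ∞} {m : ℕ}
    (h : ∀ k : Fin m, ((k + 1 : ℕ) : ℕ∞) ≤ s ↔ ((k + 1 : ℕ) : ℕ∞) ≤ s') :
    s = s' ∨ ((m : ℕ∞) ≤ s ∧ (m : ℕ∞) ≤ s') := by
  have hle : ∀ k : ℕ, k ≤ m → ((k : ℕ∞) ≤ s ↔ (k : ℕ∞) ≤ s') := by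
    intro k hk
    cases k with
    | zero => simp
    | succ k => exact h ⟨k, hk⟩
  by_cases hm : (m : ℕ∞) ≤ s
  · exact Or.inr ⟨hm, (hle m le_rfl).1 hm⟩
  · have hm' := mt (hle m le_rfl).2 hm
    push Not at hm hm'
    obtain ⟨a, rfl⟩ := ENat.ne_top_iff_exists.1 hm.ne_top
    obtain ⟨b, rfl⟩ := ENat.ne_top_iff_exists.1 hm'.ne_top
    norm_cast at hm hm' hle
    have h1 := (hle a hm.le).1 le_rfl
    have h2 := (hle b hm'.le).2 le_rfl
    exact Or.inl (by exact_mod_cast le_antisymm h1 h2)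

theorem cell_sumElim_fin_zero {α : Type} [Fintype α] {A : Type*} [BooleanAlgebra A]
    [lang.Structure A] [FinAlgebra A] (v : α → A) (xs : Fin 0 → A) (w : α ⊕ Fin 0 → Bool) :
    cell (Sum.elim v xs) w = cell v (w ∘ Sum.inl) := by
  rw [BooleanAlgebra.eq_iff_atom_le_iff]
  intro p hp
  rw [atom_le_cell_iff hp, atom_le_cell_iff hp]
  simp

theorem T₂_hasQuantifierElimination : HasQuantifierElimination T₂ := by
  intro n φ
  -- For each cell, test `Fin` (index `none`) and `C_1, …, C_m` with `m = level φ`; the shift by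
  -- `succPNat` turns indices `k < m` into thresholds `k + 1`.
  let θ : (Fin n → Bool) × Option (Fin (level φ)) → lang.Formula (Fin n) := fun p =>
    p.2.elim (finF (cellTerm p.1 (List.finRange n)))
      fun k => cF k.1.succPNat (cellTerm p.1 (List.finRange n))
  refine exists_isQF_of_determined φ θ (fun p => ?_) fun M N v v' h => ?_
  · rcases p with ⟨w, _ | k⟩
    · exact (BoundedFormula.IsAtomic.rel _ _).isQF
    · exact (BoundedFormula.IsAtomic.rel _ _).isQF
  · obtain ⟨_, _⟩ := exists_finAlgebra M
    obtain ⟨_, _⟩ := exists_finAlgebra N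
    have hfin : ∀ w, IsFin (cell v w) ↔ IsFin (cell v' w) := fun w => by
      have := h (w, none)
      simpa only [θ, Option.elim, Formula.Realize, realize_finF, realize_cellTerm] using this
    have hsize : ∀ w (k : Fin (level φ)),
        (((k + 1 : ℕ) : ℕ∞) ≤ size (cell v w) ↔ ((k + 1 : ℕ) : ℕ∞) ≤ size (cell v' w)) := by
      intro w k
      have := h (w, some k)
      simp only [θ, Option.elim, Formula.Realize, realize_cF, realize_cellTerm,
        relMap_C_iff] at this
      exact this
    have hsim : TupleSimilar (level φ) v v' := by
      exact fun w => ⟨eq_or_le_of_forall_succ_le_iff (hsize w), hfin w⟩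
    refine (realize_iff_of_tupleSimilar φ le_rfl fun w => ?_).1
    rw [cell_sumElim_fin_zero, cell_sumElim_fin_zero]
    exact hsim _

end QuantifierElimination
-- Primitive recursion on codes of terms and formulas.
section Recursion

theorem unpair_snd_lt {c : ℕ} (h : c.unpair.1 ≠ 0) : c.unpair.2 < c := by
  have := Nat.add_le_pair c.unpair.1 c.unpair.2
  rw [Nat.pair_unpair] at this
  omega

theorem unpair_snd_fst_lt {c : ℕ} (h : c.unpair.1 ≠ 0) : c.unpair.2.unpair.1 < c :=
  (Nat.unpair_left_le _).trans_lt (unpair_snd_lt h)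

theorem unpair_snd_snd_lt {c : ℕ} (h : c.unpair.1 ≠ 0) : c.unpair.2.unpair.2 < c :=
  (Nat.unpair_right_le _).trans_lt (unpair_snd_lt h)

variable {α : Type} (leaf : α → ℕ → Bool)

/-- Recursion on codes of terms: `leaf` gives the values at variables and constants, `op` those of
the operations. -/
def termRec (op : ℕ → Bool → Bool → Bool) (a : α) (c : ℕ) : Bool :=
  if _h : c.unpair.1 = 3 then op 3 (termRec op a c.unpair.2) (termRec op a c.unpair.2)
  else if _h : c.unpair.1 = 4 ∨ c.unpair.1 = 5 then
    op c.unpair.1 (termRec op a c.unpair.2.unpair.1) (termRec op a c.unpair.2.unpair.2)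
  else leaf a c
termination_by c
decreasing_by
  · exact unpair_snd_lt (by omega)
  · exact unpair_snd_fst_lt (by omega)
  · exact unpair_snd_snd_lt (by omega)

/-- Recursion on codes of formulas: `leaf` gives the values at atomic formulas, `op` interprets
implications, and the value of `∀ φ` at `a` is the conjunction of the values of `φ` at the elements
of `ext a φ`. -/
def formulaRec (op : Bool → Bool → Bool) (ext : α → ℕ → List α) (a : α) (c : ℕ) : Bool :=
  if _h : c.unpair.1 = 4 then
    op (formulaRec op ext a c.unpair.2.unpair.1) (formulaRec op ext a c.unpair.2.unpair.2)
  else if _h : c.unpair.1 = 5 then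
    (ext a c.unpair.2).all fun a' => formulaRec op ext a' c.unpair.2
  else leaf a c
termination_by c
decreasing_by
  · exact unpair_snd_fst_lt (by omega)
  · exact unpair_snd_snd_lt (by omega)
  · exact unpair_snd_lt (by omega)

open Primrec

theorem primrec_unpair_fst : Primrec fun c : ℕ => c.unpair.1 := fst.comp unpair

theorem primrec_unpair_snd : Primrec fun c : ℕ => c.unpair.2 := snd.comp unpair

theorem primrec_beq_const {β γ : Type} [Primcodable β] [Primcodable γ] [DecidableEq γ] {f : β → γ}
    (hf : Primrec f) (k : γ) : PrimrecPred fun b => f b = k :=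
  Primrec.eq.comp hf (const k)

variable [Primcodable α] {leaf}

theorem termRec_primrec {op : ℕ → Bool → Bool → Bool} (hleaf : Primrec₂ leaf)
    (hop : Primrec fun p : ℕ × Bool × Bool => op p.1 p.2.1 p.2.2) :
    Primrec₂ (termRec leaf op) := by
  have hc : Primrec fun b : α × ℕ => b.2.unpair.1 := primrec_unpair_fst.comp snd
  have hd : Primrec fun b : α × ℕ => b.2.unpair.2 := primrec_unpair_snd.comp snd
  have h3 : PrimrecPred fun b : α × ℕ => b.2.unpair.1 = 3 := primrec_beq_const hc 3
  have h45 : PrimrecPred fun b : α × ℕ => b.2.unpair.1 = 4 ∨ b.2.unpair.1 = 5 :=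
    (primrec_beq_const hc 4).or (primrec_beq_const hc 5)
  have hl : Primrec fun b : α × ℕ => (b.1, b.2.unpair.2.unpair.1) :=
    fst.pair (primrec_unpair_fst.comp hd)
  have hr : Primrec fun b : α × ℕ => (b.1, b.2.unpair.2.unpair.2) :=
    fst.pair (primrec_unpair_snd.comp hd)
  have hg : Primrec₂ fun (b : α × ℕ) (rs : List Bool) =>
      if b.2.unpair.1 = 3 then op 3 (rs.getD 0 false) (rs.getD 1 false)
      else if b.2.unpair.1 = 4 ∨ b.2.unpair.1 = 5 then
        op b.2.unpair.1 (rs.getD 0 false) (rs.getD 1 false)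
      else leaf b.1 b.2 := by
    -- The default `false` is never read: each branch that inspects `rs` makes two recursive calls.
    -- Negation lists its only argument twice for this reason.
    have h0 : Primrec fun p : (α × ℕ) × List Bool => p.2.getD 0 false :=
      (list_getD false).comp snd (const 0)
    have h1 : Primrec fun p : (α × ℕ) × List Bool => p.2.getD 1 false :=
      (list_getD false).comp snd (const 1)
    exact ite (h3.comp fst) (hop.comp ((const 3).pair (h0.pair h1)))
      (ite (h45.comp fst) (hop.comp ((hc.comp fst).pair (h0.pair h1)))
        (hleaf.comp (fst.comp fst) (snd.comp fst)))
  refine nat_omega_rec' (fun b : α × ℕ => termRec leaf op b.1 b.2) (m := Prod.snd)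
    (l := fun b => if b.2.unpair.1 = 3 then [(b.1, b.2.unpair.2), (b.1, b.2.unpair.2)]
      else if b.2.unpair.1 = 4 ∨ b.2.unpair.1 = 5 then
        [(b.1, b.2.unpair.2.unpair.1), (b.1, b.2.unpair.2.unpair.2)] else [])
    snd ?_ (option_some.comp₂ hg) ?_ ?_
  · refine ite h3 ?_ (ite h45 ?_ (const []))
    · exact list_cons.comp (fst.pair hd) (list_cons.comp (fst.pair hd) (const []))
    · exact list_cons.comp hl (list_cons.comp hr (const []))
  · rintro ⟨a, c⟩ b' hb'
    dsimp only at hb' ⊢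
    split_ifs at hb' with h h
    · have := unpair_snd_lt (c := c) (by omega)
      simp only [List.mem_cons, List.not_mem_nil, or_false, or_self] at hb'
      rw [hb']
      exact this
    · have h1 := unpair_snd_fst_lt (c := c) (by omega)
      have h2 := unpair_snd_snd_lt (c := c) (by omega)
      simp only [List.mem_cons, List.not_mem_nil, or_false] at hb'
      rcases hb' with rfl | rfl
      exacts [h1, h2]
    · simp at hb'
  · rintro ⟨a, c⟩
    dsimp only
    rw [termRec]
    split_ifs <;> simp

theorem list_all_primrec : Primrec fun l : List Bool => l.all id := by
  have : Primrec fun l : List Bool => l.foldr (fun x s => x && s) true :=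
    list_foldr Primrec.id (const true)
      ((Primrec.and.comp (fst.comp snd) (snd.comp snd)).to₂)
  refine this.of_eq fun l => ?_
  induction l with
  | nil => rfl
  | cons x l ih => simp [ih]

/-- The parameter changes under a quantifier, so the course-of-values recursion runs on pairs of a
parameter and a code, with the code as decreasing measure and the list of subcalls computed from the
pair. -/
theorem formulaRec_primrec {op : Bool → Bool → Bool} {ext : α → ℕ → List α}
    (hleaf : Primrec₂ leaf) (hext : Primrec₂ ext) : Primrec₂ (formulaRec leaf op ext) := by
  have hc : Primrec fun b : α × ℕ => b.2.unpair.1 := primrec_unpair_fst.comp snd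
  have hd : Primrec fun b : α × ℕ => b.2.unpair.2 := primrec_unpair_snd.comp snd
  have h4 : PrimrecPred fun b : α × ℕ => b.2.unpair.1 = 4 := primrec_beq_const hc 4
  have h5 : PrimrecPred fun b : α × ℕ => b.2.unpair.1 = 5 := primrec_beq_const hc 5
  have hl : Primrec fun b : α × ℕ => (b.1, b.2.unpair.2.unpair.1) :=
    fst.pair (primrec_unpair_fst.comp hd)
  have hr : Primrec fun b : α × ℕ => (b.1, b.2.unpair.2.unpair.2) :=
    fst.pair (primrec_unpair_snd.comp hd)
  have hg : Primrec₂ fun (b : α × ℕ) (rs : List Bool) =>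
      if b.2.unpair.1 = 4 then op (rs.getD 0 false) (rs.getD 1 false)
      else if b.2.unpair.1 = 5 then rs.all id
      else leaf b.1 b.2 := by
    have h0 : Primrec fun p : (α × ℕ) × List Bool => p.2.getD 0 false :=
      (list_getD false).comp snd (const 0)
    have h1 : Primrec fun p : (α × ℕ) × List Bool => p.2.getD 1 false :=
      (list_getD false).comp snd (const 1)
    exact ite (h4.comp fst) ((dom_bool₂ op).comp h0 h1)
      (ite (h5.comp fst) (list_all_primrec.comp snd)
        (hleaf.comp (fst.comp fst) (snd.comp fst)))
  refine nat_omega_rec' (fun b : α × ℕ => formulaRec leaf op ext b.1 b.2) (m := Prod.snd)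
    (l := fun b => if b.2.unpair.1 = 4 then
        [(b.1, b.2.unpair.2.unpair.1), (b.1, b.2.unpair.2.unpair.2)]
      else if b.2.unpair.1 = 5 then (ext b.1 b.2.unpair.2).map fun a => (a, b.2.unpair.2) else [])
    snd ?_ (option_some.comp₂ hg) ?_ ?_
  · refine ite h4 (list_cons.comp hl (list_cons.comp hr (const []))) (ite h5 ?_ (const []))
    exact list_map (hext.comp fst hd) (snd.pair (hd.comp fst)).to₂
  · rintro ⟨a, c⟩ b' hb'
    dsimp only at hb' ⊢
    split_ifs at hb' with h h
    · have h1 := unpair_snd_fst_lt (c := c) (by omega)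
      have h2 := unpair_snd_snd_lt (c := c) (by omega)
      simp only [List.mem_cons, List.not_mem_nil, or_false] at hb'
      rcases hb' with rfl | rfl
      exacts [h1, h2]
    · obtain ⟨a', -, rfl⟩ := List.mem_map.1 hb'
      exact unpair_snd_lt (c := c) (by omega)
    · simp at hb'
  · rintro ⟨a, c⟩
    dsimp only
    rw [formulaRec]
    split_ifs <;> simp [List.all_map, Function.comp_def]

end Recursion

/-! ### Recognizing codes of formulas. -/

section WellFormed

/-- Whether a variable or constant code is valid with `n` variables in scope. -/
def termLeafValid (n c : ℕ) : Bool :=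
  if c.unpair.1 = 0 then decide (c.unpair.2 < n)
  else decide ((c.unpair.1 = 1 ∨ c.unpair.1 = 2) ∧ c.unpair.2 = 0)

/-- Whether a number is the code of a term with `n` variables in scope. -/
def termValid : ℕ → ℕ → Bool := termRec termLeafValid fun _ x y => x && y

/-- Whether a number is the code of an atomic formula with `n` variables in scope. -/
def atomicValid (n c : ℕ) : Bool :=
  if c.unpair.1 = 0 then decide (c.unpair.2 = 0)
  else if c.unpair.1 = 1 then
    termValid n c.unpair.2.unpair.1 && termValid n c.unpair.2.unpair.2
  else if c.unpair.1 = 2 then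
    decide (0 < c.unpair.2.unpair.1) && termValid n c.unpair.2.unpair.2
  else if c.unpair.1 = 3 then termValid n c.unpair.2
  else false

/-- Whether a number is the code of a formula with `n` variables in scope. -/
def formulaValid : ℕ → ℕ → Bool :=
  formulaRec atomicValid (fun x y => x && y) fun n _ => [n + 1]

open Primrec in
theorem termValid_primrec : Primrec₂ termValid := by
  have hc : Primrec fun b : ℕ × ℕ => b.2.unpair.1 := primrec_unpair_fst.comp snd
  have hd : Primrec fun b : ℕ × ℕ => b.2.unpair.2 := primrec_unpair_snd.comp snd
  refine termRec_primrec ?_ (Primrec.and.comp (fst.comp snd) (snd.comp snd))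
  exact ite (primrec_beq_const hc 0) (nat_lt.comp hd fst).decide
    (((primrec_beq_const hc 1).or (primrec_beq_const hc 2)).and (primrec_beq_const hd 0)).decide

open Primrec in
theorem formulaValid_primrec : Primrec₂ formulaValid := by
  have hc : Primrec fun b : ℕ × ℕ => b.2.unpair.1 := primrec_unpair_fst.comp snd
  have hd : Primrec fun b : ℕ × ℕ => b.2.unpair.2 := primrec_unpair_snd.comp snd
  have hl := primrec_unpair_fst.comp hd
  have hr := primrec_unpair_snd.comp hd
  refine formulaRec_primrec ?_ (list_cons.comp (succ.comp fst) (const []))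
  refine ite (primrec_beq_const hc 0) (primrec_beq_const hd 0).decide
    (ite (primrec_beq_const hc 1) ?_ (ite (primrec_beq_const hc 2) ?_
      (ite (primrec_beq_const hc 3) ?_ (const false))))
  · exact Primrec.and.comp (termValid_primrec.comp fst hl) (termValid_primrec.comp fst hr)
  · exact Primrec.and.comp (nat_lt.comp (const 0) hl).decide (termValid_primrec.comp fst hr)
  · exact termValid_primrec.comp fst hd

theorem termValid_termCode {n : ℕ} (t : lang.Term (Empty ⊕ Fin n)) :
    termValid n (termCode t) = true := by
  induction t with
  | var i =>
    rcases i with e | i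
    · exact e.elim
    · rw [termValid, termRec]
      simp [termCode, termLeafValid]
  | func f ts ih =>
    cases f <;> rw [termValid, termRec] <;> simp [termCode, termLeafValid] <;>
      simp only [← termValid.eq_1] <;> simp [ih]

theorem exists_termCode_eq {n : ℕ} (c : ℕ) (h : termValid n c = true) :
    ∃ t : lang.Term (Empty ⊕ Fin n), termCode t = c := by
  induction c using Nat.strong_induction_on with
  | _ c ih =>
  rw [termValid, termRec] at h
  simp only [← termValid.eq_1] at h
  split_ifs at h with h3 h4
  · obtain ⟨t, ht⟩ := ih _ (unpair_snd_lt (by omega)) (Bool.and_eq_true_iff.1 h).1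
    exact ⟨.func Func.compl ![t], by simp [termCode, ht, ← h3]⟩
  · rw [Bool.and_eq_true_iff] at h
    obtain ⟨s, hs⟩ := ih _ (unpair_snd_fst_lt (by omega)) h.1
    obtain ⟨t, ht⟩ := ih _ (unpair_snd_snd_lt (by omega)) h.2
    rcases h4 with h4 | h4
    · exact ⟨.func Func.inf ![s, t], by simp [termCode, hs, ht, ← h4]⟩
    · exact ⟨.func Func.sup ![s, t], by simp [termCode, hs, ht, ← h4]⟩
  · rw [termLeafValid] at h
    split_ifs at h with h0
    · exact ⟨.var (Sum.inr ⟨c.unpair.2, of_decide_eq_true h⟩), by simp [termCode, ← h0]⟩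
    · obtain ⟨h1 | h1, h2⟩ := of_decide_eq_true h
      · exact ⟨.func Func.bot ![], by rw [termCode, ← h1, ← h2, Nat.pair_unpair]⟩
      · exact ⟨.func Func.top ![], by rw [termCode, ← h1, ← h2, Nat.pair_unpair]⟩

theorem formulaValid_code {n : ℕ} (φ : lang.BoundedFormula Empty n) :
    formulaValid n (code φ) = true := by
  induction φ with
  | falsum => rw [formulaValid, formulaRec]; simp [code, atomicValid]
  | equal s t =>
    rw [formulaValid, formulaRec]; simp [code, atomicValid, termValid_termCode]
  | rel r ts =>
    rw [formulaValid, formulaRec]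
    cases r <;> simp [code, atomicValid, termValid_termCode]
  | imp φ ψ ih1 ih2 =>
    rw [formulaValid] at *
    rw [formulaRec]
    simp [code, ih1, ih2]
  | all φ ih =>
    rw [formulaValid] at *
    rw [formulaRec]
    simp [code, ih]

theorem exists_code_eq (c : ℕ) {n : ℕ} (h : formulaValid n c = true) :
    ∃ φ : lang.BoundedFormula Empty n, code φ = c := by
  induction c using Nat.strong_induction_on generalizing n with
  | _ c ih =>
  rw [formulaValid, formulaRec] at h
  simp only [← formulaValid.eq_1] at h
  split_ifs at h with h4 h5
  · rw [Bool.and_eq_true_iff] at h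
    obtain ⟨φ, hφ⟩ := ih _ (unpair_snd_fst_lt (by omega)) h.1
    obtain ⟨ψ, hψ⟩ := ih _ (unpair_snd_snd_lt (by omega)) h.2
    exact ⟨.imp φ ψ, by simp [code, hφ, hψ, ← h4]⟩
  · obtain ⟨φ, hφ⟩ := ih _ (unpair_snd_lt (by omega)) (n := n + 1) (by simpa using h)
    exact ⟨.all φ, by simp [code, hφ, ← h5]⟩
  · rw [atomicValid] at h
    split_ifs at h with h0 h1 h2 h3
    · exact ⟨.falsum, by
        rw [code, ← Nat.pair_unpair c, h0, of_decide_eq_true h]⟩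
    · rw [Bool.and_eq_true_iff] at h
      obtain ⟨s, hs⟩ := exists_termCode_eq _ h.1
      obtain ⟨t, ht⟩ := exists_termCode_eq _ h.2
      exact ⟨.equal s t, by simp [code, hs, ht, ← h1]⟩
    · rw [Bool.and_eq_true_iff] at h
      obtain ⟨t, ht⟩ := exists_termCode_eq _ h.2
      exact ⟨.rel (Rel.C ⟨_, of_decide_eq_true h.1⟩) ![t], by simp [code, ht, ← h2]⟩
    · obtain ⟨t, ht⟩ := exists_termCode_eq _ h
      exact ⟨.rel Rel.fin ![t], by simp [code, ht, ← h3]⟩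

end WellFormed
-- Evaluating formulas in the powerset of `ℕ` on descriptions of partitions.
section Truth

/-- The size of a cell: `(true, _)` stands for infinity and `(false, k)` for `k`. -/
abbrev SizeCode : Type := Bool × ℕ

/-- A description of a partition: the profiles of the cells, with their sizes. -/
abbrev Partition : Type := List (List Bool × SizeCode)

/-- The cardinality described by a size code. -/
def SizeCode.toENat (z : SizeCode) : ℕ∞ := if z.1 then ⊤ else z.2

/-- The total size of the cells whose profiles satisfy `P`. -/
def mass (P : List Bool → Bool) (σ : Partition) : SizeCode :=
  σ.foldr (fun c s => if P c.1 then (c.2.1 || s.1, c.2.2 + s.2) else s) (false, 0)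

/-- The value of the variable or constant with a given code at points with a given profile. -/
def termLeafValue (v : List Bool) (c : ℕ) : Bool :=
  if c.unpair.1 = 0 then v.getD c.unpair.2 false else decide (c.unpair.1 = 2)

/-- The Boolean operation whose symbol is coded by `k`. -/
def codedOp (k : ℕ) (x y : Bool) : Bool := if k = 3 then !x else if k = 4 then x && y else x || y

/-- The value of the term with a given code at points with a given profile. -/
def termValue : List Bool → ℕ → Bool := termRec termLeafValue codedOp

/-- The truth value of the atomic formula with a given code. -/
def atomicTruth (σ : Partition) (c : ℕ) : Bool :=
  if c.unpair.1 = 1 then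
    decide (mass (fun v => xor (termValue v c.unpair.2.unpair.1)
      (termValue v c.unpair.2.unpair.2)) σ = (false, 0))
  else if c.unpair.1 = 2 then
    (mass (fun v => termValue v c.unpair.2.unpair.2) σ).1 ||
      decide (c.unpair.2.unpair.1 ≤ (mass (fun v => termValue v c.unpair.2.unpair.2) σ).2)
  else if c.unpair.1 = 3 then !(mass (fun v => termValue v c.unpair.2) σ).1
  else false

/-- The sizes of the parts in sufficiently many decompositions of a cell into two parts. -/
def sizeSplits (m : ℕ) (z : SizeCode) : List (SizeCode × SizeCode) :=
  if z.1 then ((true, 0), (true, 0)) ::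
    ((List.range (m + 1)).map (fun i => ((false, i), (true, 0))) ++
      (List.range (m + 1)).map fun i => ((true, 0), (false, i)))
  else (List.range (z.2 + 1)).map fun i => ((false, i), (false, z.2 - i))

/-- The refinements of a partition by a further set, up to similarity at level `m`. -/
def splits (m : ℕ) (σ : Partition) : List Partition :=
  σ.foldr (fun c acc => (sizeSplits m c.2).flatMap fun z => acc.map fun τ =>
    (c.1 ++ [true], z.1) :: (c.1 ++ [false], z.2) :: τ) [ [] ]

/-- The truth value of the formula with a given code. -/
def truth : Partition → ℕ → Bool :=
  formulaRec atomicTruth (fun x y => !x || y) fun σ c => splits (2 ^ c) σ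

section Primrec

open Primrec

theorem mass_primrec {β : Type} [Primcodable β] {P : β → List Bool → Bool} {σ : β → Partition}
    (hP : Primrec₂ P) (hσ : Primrec σ) : Primrec fun b => mass (P b) (σ b) := by
  refine list_foldr (h := fun b p => if P b p.1.1 then (p.1.2.1 || p.2.1, p.1.2.2 + p.2.2) else p.2)
    hσ (const (false, 0)) ?_
  have hc : Primrec fun p : β × (List Bool × SizeCode) × SizeCode => p.2.1.2 :=
    snd.comp (fst.comp snd)
  have hs : Primrec fun p : β × (List Bool × SizeCode) × SizeCode => p.2.2 := snd.comp snd
  refine ite (Primrec.eq.comp (hP.comp fst (fst.comp (fst.comp snd))) (const true)) ?_ hs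
  exact (Primrec.or.comp (fst.comp hc) (fst.comp hs)).pair
    (nat_add.comp (snd.comp hc) (snd.comp hs))

theorem termValue_primrec : Primrec₂ termValue := by
  have hc : Primrec fun b : List Bool × ℕ => b.2.unpair.1 := primrec_unpair_fst.comp snd
  have hd : Primrec fun b : List Bool × ℕ => b.2.unpair.2 := primrec_unpair_snd.comp snd
  refine termRec_primrec ?_ ?_
  · exact ite (primrec_beq_const hc 0) ((list_getD false).comp fst hd)
      (primrec_beq_const hc 2).decide
  · have hx : Primrec fun p : ℕ × Bool × Bool => p.2.1 := fst.comp snd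
    have hy : Primrec fun p : ℕ × Bool × Bool => p.2.2 := snd.comp snd
    exact ite (primrec_beq_const fst 3) (Primrec.not.comp hx)
      (ite (primrec_beq_const fst 4) (Primrec.and.comp hx hy) (Primrec.or.comp hx hy))

theorem atomicTruth_primrec : Primrec₂ atomicTruth := by
  have hc : Primrec fun b : Partition × ℕ => b.2.unpair.1 := primrec_unpair_fst.comp snd
  have hd : Primrec fun b : Partition × ℕ => b.2.unpair.2 := primrec_unpair_snd.comp snd
  have hl := primrec_unpair_fst.comp hd
  have hr := primrec_unpair_snd.comp hd
  have hval {f : Partition × ℕ → ℕ} (hf : Primrec f) :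
      Primrec₂ fun (b : Partition × ℕ) (v : List Bool) => termValue v (f b) :=
    termValue_primrec.comp snd (hf.comp fst)
  refine ite (primrec_beq_const hc 1) ?_ (ite (primrec_beq_const hc 2) ?_
    (ite (primrec_beq_const hc 3) ?_ (const false)))
  · exact (primrec_beq_const (mass_primrec ((dom_bool₂ xor).comp₂ (hval hl) (hval hr)) fst)
      (false, 0)).decide
  · exact Primrec.or.comp (fst.comp (mass_primrec (hval hr) fst))
      (nat_le.comp hl (snd.comp (mass_primrec (hval hr) fst))).decide
  · exact Primrec.not.comp (fst.comp (mass_primrec (hval hd) fst))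

theorem sizeSplits_primrec : Primrec₂ sizeSplits := by
  have hm : Primrec fun p : ℕ × SizeCode => List.range (p.1 + 1) :=
    list_range.comp (succ.comp fst)
  have hz : Primrec fun p : ℕ × SizeCode => p.2.2 := snd.comp snd
  refine ite (Primrec.eq.comp (fst.comp snd) (const true)) ?_ ?_
  · refine list_cons.comp (const _) (list_append.comp (list_map hm ?_) (list_map hm ?_))
    · exact ((const false).pair snd).pair (const (true, 0))
    · exact (const (true, 0)).pair ((const false).pair snd)
  · refine list_map (list_range.comp (succ.comp hz)) ?_
    exact ((const false).pair snd).pair ((const false).pair (nat_sub.comp (hz.comp fst) snd))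

theorem splits_primrec : Primrec₂ splits := by
  refine list_foldr (f := fun p : ℕ × Partition => p.2) (g := fun _ => [ [] ])
    (h := fun p q => (sizeSplits p.1 q.1.2).flatMap fun z => q.2.map fun τ =>
      (q.1.1 ++ [true], z.1) :: (q.1.1 ++ [false], z.2) :: τ) snd (const _) ?_
  refine list_flatMap (sizeSplits_primrec.comp (fst.comp fst) (snd.comp (fst.comp snd))) ?_
  refine list_map (snd.comp (snd.comp fst)) ?_
  have hv : Primrec fun q : (((ℕ × Partition) × (List Bool × SizeCode) × List Partition) ×
      SizeCode × SizeCode) × Partition => q.1.1.2.1.1 :=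
    fst.comp (fst.comp (snd.comp (fst.comp fst)))
  have hz : Primrec fun q : (((ℕ × Partition) × (List Bool × SizeCode) × List Partition) ×
      SizeCode × SizeCode) × Partition => q.1.2 := snd.comp fst
  exact list_cons.comp ((list_concat.comp hv (const true)).pair (fst.comp hz))
    (list_cons.comp ((list_concat.comp hv (const false)).pair (snd.comp hz)) snd)

theorem two_pow_primrec : Primrec fun n : ℕ => 2 ^ n :=
  (nat_rec₁ (f := fun _ x => 2 * x) 1 (nat_mul.comp (const 2) snd)).of_eq fun n => by
    induction n with
    | zero => rfl
    | succ n ih =>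
      change 2 * _ = _
      rw [ih, pow_succ, mul_comm]

theorem truth_primrec : Primrec₂ truth :=
  formulaRec_primrec atomicTruth_primrec (splits_primrec.comp (two_pow_primrec.comp snd) fst)

end Primrec

/-- `σ` describes the partition of `X` generated by the tuple `a`. -/
def Describes {n : ℕ} (a : Fin n → Set ℕ) : Partition → Set ℕ → Prop
  | [], X => X = ∅
  | c :: σ, X => c.1.length = n ∧ ∃ Y ⊆ X, Y.encard = c.2.toENat ∧
      (∀ p ∈ Y, ∀ i : Fin n, p ∈ a i ↔ c.1.getD i false = true) ∧ Describes a σ (X \ Y)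

theorem Describes.congr {n : ℕ} {a b : Fin n → Set ℕ} {σ : Partition} {X : Set ℕ}
    (h : Describes a σ X) (hab : ∀ p ∈ X, ∀ i, p ∈ a i ↔ p ∈ b i) : Describes b σ X := by
  induction σ generalizing X with
  | nil => exact h
  | cons c σ ih =>
    obtain ⟨hl, Y, hY, hc, hp, hr⟩ := h
    exact ⟨hl, Y, hY, hc, fun p hpY i => (hab p (hY hpY) i).symm.trans (hp p hpY i),
      ih hr fun p hpX => hab p hpX.1⟩

theorem mass_cons (P : List Bool → Bool) (c : List Bool × SizeCode) (σ : Partition) :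
    (mass P (c :: σ)).toENat = (if P c.1 then c.2.toENat else 0) + (mass P σ).toENat := by
  change SizeCode.toENat (if P c.1 then (c.2.1 || (mass P σ).1, c.2.2 + (mass P σ).2)
    else mass P σ) = _
  generalize mass P σ = s
  obtain ⟨v, b, k⟩ := c
  obtain ⟨b', k'⟩ := s
  cases P v <;> cases b <;> cases b' <;> simp [SizeCode.toENat]

/-- Membership in `S` depends only on the profile, so each listed cell is contained in `S` or
disjoint from it, and the sizes of the former add up. -/
theorem Describes.encard_inter {n : ℕ} {a : Fin n → Set ℕ} {σ : Partition} {X : Set ℕ}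
    (h : Describes a σ X) {S : Set ℕ} {P : List Bool → Bool}
    (hP : ∀ v p, (∀ i : Fin n, p ∈ a i ↔ v.getD i false = true) → (p ∈ S ↔ P v = true)) :
    (X ∩ S).encard = (mass P σ).toENat := by
  induction σ generalizing X with
  | nil =>
    rw [show X = ∅ from h]
    simp [mass, SizeCode.toENat]
  | cons c σ ih =>
    obtain ⟨hl, Y, hY, hc, hp, hr⟩ := h
    rw [mass_cons, ← ih hr, ← hc]
    have hX : X ∩ S = (Y ∩ S) ∪ ((X \ Y) ∩ S) := by
      rw [← Set.union_inter_distrib_right, Set.union_sdiff_cancel hY]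
    rw [hX, Set.encard_union_eq]
    · congr 1
      split_ifs with hv
      · rw [Set.inter_eq_left.2 fun p hpY => (hP _ p (hp p hpY)).2 hv]
      · rw [Set.encard_eq_zero, Set.eq_empty_iff_forall_notMem]
        rintro p ⟨hpY, hpS⟩
        exact hv ((hP _ p (hp p hpY)).1 hpS)
    · exact Set.disjoint_sdiff_right.mono Set.inter_subset_left Set.inter_subset_left

theorem termValue_termCode {n : ℕ} (v : List Bool) (t : lang.Term (Empty ⊕ Fin n)) :
    termValue v (termCode t) =
      evalBool (Sum.elim Empty.elim fun i : Fin n => v.getD i false) t := by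
  induction t with
  | var i =>
    rcases i with e | i
    · exact e.elim
    · rw [termValue, termRec]
      simp [termCode, evalBool, termLeafValue, codedOp]
  | func f ts ih =>
    cases f <;> rw [termValue, termRec] <;> simp [termCode, evalBool, termLeafValue, codedOp] <;>
      simp only [← termValue.eq_1] <;> simp [ih]

theorem mem_realize_iff {n : ℕ} (t : lang.Term (Empty ⊕ Fin n)) {e : Empty → Set ℕ}
    {a : Fin n → Set ℕ} (v : List Bool)
    (p : ℕ) (h : ∀ i : Fin n, p ∈ a i ↔ v.getD i false = true) :
    p ∈ t.realize (Sum.elim e a) ↔ termValue v (termCode t) = true := by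
  rw [termValue_termCode]
  have := atom_le_realize_iff (p := ({p} : Set ℕ)) (Set.isAtom_singleton p)
    (a := Sum.elim e a)
    (w := Sum.elim Empty.elim fun i : Fin n => v.getD i false) (fun i => ?_) t
  · rw [← this]
    simp
  · rcases i with e | i
    · exact e.elim
    · simp [h i]

end Truth
-- Correctness of the evaluation, and decidability.
section TruthCorrect

theorem exists_toENat_eq (s : ℕ∞) : ∃ z : SizeCode, z.toENat = s := by
  cases s with
  | top => exact ⟨(true, 0), rfl⟩
  | coe k => exact ⟨(false, k), rfl⟩

/-- Size codes of cardinalities that are similar at level `m`. -/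
def SizeSimilar (m : ℕ) (z z' : SizeCode) : Prop :=
  (z.toENat = z'.toENat ∨ ((m : ℕ∞) ≤ z.toENat ∧ (m : ℕ∞) ≤ z'.toENat)) ∧
    (z.toENat = ⊤ ↔ z'.toENat = ⊤)

theorem exists_subset_of_mem_sizeSplits {m : ℕ} {z : SizeCode} {zz : SizeCode × SizeCode}
    (h : zz ∈ sizeSplits m z) {Y : Set ℕ} (hY : Y.encard = z.toENat) :
    ∃ Z ⊆ Y, Z.encard = zz.1.toENat ∧ (Y \ Z).encard = zz.2.toENat := by
  obtain ⟨b, k⟩ := z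
  cases b with
  | true =>
    have hinf : Y.Infinite := Set.encard_eq_top_iff.1 hY
    have hfin : ∀ i : ℕ, ∃ Z ⊆ Y, Z.encard = i ∧ (Y \ Z).encard = ⊤ := by
      intro i
      obtain ⟨Z, hZ, hi⟩ := Set.exists_subset_encard_eq (s := Y) (k := i) (by rw [hY]; exact le_top)
      refine ⟨Z, hZ, hi, Set.encard_eq_top_iff.2 (hinf.sdiff (Set.finite_of_encard_eq_coe hi))⟩
    simp only [sizeSplits, if_true, List.mem_cons, List.mem_append, List.mem_map] at h
    rcases h with rfl | ⟨i, -, rfl⟩ | ⟨i, -, rfl⟩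
    · obtain ⟨Z, hZ, h1, h2⟩ := exists_infinite_split hinf
      exact ⟨Z, hZ, Set.encard_eq_top_iff.2 h1, Set.encard_eq_top_iff.2 h2⟩
    · obtain ⟨Z, hZ, h1, h2⟩ := hfin i
      exact ⟨Z, hZ, h1, h2⟩
    · obtain ⟨Z, hZ, h1, h2⟩ := hfin i
      exact ⟨Y \ Z, Set.sdiff_subset, h2, by rw [Set.sdiff_sdiff_cancel_left hZ]; exact h1⟩
  | false =>
    simp only [sizeSplits, Bool.false_eq_true, if_false, List.mem_map, List.mem_range] at h
    obtain ⟨i, hi, rfl⟩ := h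
    have hY : Y.encard = k := hY
    have hi : i < k + 1 := hi
    obtain ⟨Z, hZ, h1⟩ := Set.exists_subset_encard_eq (s := Y) (k := i)
      (by rw [hY]; exact_mod_cast Nat.lt_succ_iff.1 hi)
    refine ⟨Z, hZ, h1, ?_⟩
    have := Set.encard_sdiff_add_encard_of_subset hZ
    rw [h1, hY] at this
    change _ = ((k - i : ℕ) : ℕ∞)
    have hk : (k : ℕ∞) = ((k - i : ℕ) : ℕ∞) + (i : ℕ∞) := by
      rw [← Nat.cast_add, Nat.sub_add_cancel (by omega)]
    exact WithTop.add_right_cancel (ENat.natCast_ne_top i) (this.trans hk)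

/-- Splits of a finite cell are all listed exactly. In an infinite cell a finite part of size `j` is
represented by `min j m`, which is indistinguishable from `j` at level `m`. -/
theorem exists_mem_sizeSplits (m : ℕ) {z : SizeCode} {Y Z : Set ℕ} (hY : Y.encard = z.toENat)
    (hZ : Z ⊆ Y) : ∃ zz ∈ sizeSplits m z, ∃ z₁ z₂ : SizeCode, Z.encard = z₁.toENat ∧
      (Y \ Z).encard = z₂.toENat ∧ SizeSimilar m z₁ zz.1 ∧ SizeSimilar m z₂ zz.2 := by
  obtain ⟨z₁, h1⟩ := exists_toENat_eq Z.encard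
  obtain ⟨z₂, h2⟩ := exists_toENat_eq (Y \ Z).encard
  have hadd := Set.encard_sdiff_add_encard_of_subset hZ
  rw [← h1, ← h2, hY] at hadd
  suffices h : ∃ zz ∈ sizeSplits m z, SizeSimilar m z₁ zz.1 ∧ SizeSimilar m z₂ zz.2 by
    obtain ⟨zz, h3, h4⟩ := h
    exact ⟨zz, h3, z₁, z₂, h1.symm, h2.symm, h4⟩
  clear h1 h2
  obtain ⟨b, k⟩ := z
  obtain ⟨b₁, k₁⟩ := z₁
  obtain ⟨b₂, k₂⟩ := z₂
  have hmin : ∀ j : ℕ, SizeSimilar m (false, j) (false, min j m) := by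
    intro j
    refine ⟨?_, by simp [SizeCode.toENat]⟩
    rcases le_total j m with h | h
    · exact Or.inl (by rw [min_eq_left h])
    · refine Or.inr ⟨?_, ?_⟩ <;> simp [SizeCode.toENat, h]
  have htop : ∀ j j' : ℕ, SizeSimilar m (true, j) (true, j') := fun j j' =>
    ⟨Or.inl rfl, Iff.rfl⟩
  have hrefl : ∀ z, SizeSimilar m z z := fun z => ⟨Or.inl rfl, Iff.rfl⟩
  have hle : ∀ j : ℕ, min j m < m + 1 := fun j => Nat.lt_succ_of_le (min_le_right _ _)
  cases b with
  | true =>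
    simp only [sizeSplits, if_true, List.mem_cons, List.mem_append, List.mem_map, List.mem_range]
    cases b₁ <;> cases b₂
    · simp only [SizeCode.toENat, Bool.false_eq_true, if_false, if_true] at hadd
      exact (ENat.natCast_ne_top (k₂ + k₁) (by exact_mod_cast hadd)).elim
    · exact ⟨_, Or.inr (Or.inl ⟨min k₁ m, hle _, rfl⟩), hmin _, htop _ _⟩
    · exact ⟨_, Or.inr (Or.inr ⟨min k₂ m, hle _, rfl⟩), htop _ _, hmin _⟩
    · exact ⟨_, Or.inl rfl, htop _ _, htop _ _⟩
  | false =>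
    simp only [sizeSplits, Bool.false_eq_true, if_false, List.mem_map, List.mem_range]
    cases b₁ <;> cases b₂ <;>
      simp only [SizeCode.toENat, Bool.false_eq_true, if_false, if_true, top_add, add_top] at hadd
    · have hk : k₂ + k₁ = k := by exact_mod_cast hadd
      refine ⟨_, ⟨k₁, by omega, rfl⟩, hrefl _, ?_⟩
      rw [← hk, Nat.add_sub_cancel]
      exact hrefl _
    · exact (ENat.natCast_ne_top k hadd.symm).elim
    · exact (ENat.natCast_ne_top k hadd.symm).elim
    · exact (ENat.natCast_ne_top k hadd.symm).elim

theorem mem_splits_cons {m : ℕ} {c : List Bool × SizeCode} {σ τ : Partition} :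
    τ ∈ splits m (c :: σ) ↔ ∃ z ∈ sizeSplits m c.2, ∃ τ' ∈ splits m σ,
      (c.1 ++ [true], z.1) :: (c.1 ++ [false], z.2) :: τ' = τ := by
  change τ ∈ (sizeSplits m c.2).flatMap (fun z => (splits m σ).map fun τ =>
    (c.1 ++ [true], z.1) :: (c.1 ++ [false], z.2) :: τ) ↔ _
  simp only [List.mem_flatMap, List.mem_map]

theorem mem_snoc_iff {n : ℕ} {a : Fin n → Set ℕ} {v : List Bool} (hv : v.length = n) (x : Set ℕ)
    (b : Bool) (p : ℕ) (h : ∀ i : Fin n, p ∈ a i ↔ v.getD i false = true)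
    (hx : p ∈ x ↔ b = true) (i : Fin (n + 1)) :
    p ∈ (Fin.snoc a x : Fin (n + 1) → Set ℕ) i ↔ (v ++ [b]).getD i false = true := by
  -- The exact length of `v` matters: it puts the appended bit at the index of the new variable.
  subst hv
  induction i using Fin.lastCases with
  | last => simp [hx]
  | cast i =>
    rw [Fin.snoc_castSucc, h i]
    simp

theorem Describes.cons_cons {n : ℕ} {a : Fin n → Set ℕ} {X Y Z x : Set ℕ} {v : List Bool}
    (hv : v.length = n) (hY : Y ⊆ X) (hZ : Z ⊆ Y) (hx : Y ∩ x = Z) {z₁ z₂ : SizeCode}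
    (h1 : Z.encard = z₁.toENat) (h2 : (Y \ Z).encard = z₂.toENat)
    (hp : ∀ p ∈ Y, ∀ i : Fin n, p ∈ a i ↔ v.getD i false = true) {τ : Partition}
    (hτ : Describes (Fin.snoc a x : Fin (n + 1) → Set ℕ) τ (X \ Y)) :
    Describes (Fin.snoc a x : Fin (n + 1) → Set ℕ)
      ((v ++ [true], z₁) :: (v ++ [false], z₂) :: τ) X := by
  refine ⟨by simp [hv], Z, hZ.trans hY, h1, fun p hpZ => ?_, by simp [hv], Y \ Z,
    Set.sdiff_subset_sdiff_left hY, h2, fun p hpY => ?_, ?_⟩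
  · exact mem_snoc_iff hv x true p (hp p (hZ hpZ)) (by simp; rw [← hx] at hpZ; exact hpZ.2)
  · refine mem_snoc_iff hv x false p (hp p hpY.1) ?_
    simp only [Bool.false_eq_true, iff_false]
    exact fun hpx => hpY.2 (hx ▸ ⟨hpY.1, hpx⟩)
  · rwa [Set.sdiff_sdiff, Set.union_sdiff_cancel hZ]

/-- Soundness of the search: choose a part of the prescribed size in each cell and take the union.
The part chosen in `Y` does not affect the description of `X \ Y`, by `Describes.congr`. -/
theorem Describes.exists_of_mem_splits {n : ℕ} {a : Fin n → Set ℕ} {σ τ : Partition} {X : Set ℕ}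
    {m : ℕ} (h : Describes a σ X) (hτ : τ ∈ splits m σ) :
    ∃ x ⊆ X, Describes (Fin.snoc a x : Fin (n + 1) → Set ℕ) τ X := by
  induction σ generalizing X τ with
  | nil =>
    rw [show τ = [] by simpa [splits] using hτ]
    exact ⟨∅, Set.empty_subset _, h⟩
  | cons c σ ih =>
    obtain ⟨hl, Y, hY, hc, hp, hr⟩ := h
    obtain ⟨z, hz, τ₀, hτ₀, rfl⟩ := mem_splits_cons.1 hτ
    obtain ⟨Z, hZ, h1, h2⟩ := exists_subset_of_mem_sizeSplits hz hc
    obtain ⟨x, hx, hd⟩ := ih hr hτ₀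
    refine ⟨Z ∪ x, Set.union_subset (hZ.trans hY) (hx.trans Set.sdiff_subset),
      Describes.cons_cons hl hY hZ ?_ h1 h2 hp (hd.congr fun p hpX i => ?_)⟩
    · rw [Set.inter_union_distrib_left, Set.inter_eq_right.2 hZ, Set.union_eq_left]
      rintro p ⟨hpY, hpx⟩
      exact ((hx hpx).2 hpY).elim
    · induction i using Fin.lastCases with
      | last =>
        simp only [Fin.snoc_last, Set.mem_union]
        exact ⟨Or.inr, fun h => h.resolve_left fun hpZ => hpX.2 (hZ hpZ)⟩
      | cast i => simp only [Fin.snoc_castSucc]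

/-- Partitions with the same profiles and sizes that are similar at level `m`. -/
def PartitionSimilar (m : ℕ) : Partition → Partition → Prop :=
  List.Forall₂ fun c c' => c.1 = c'.1 ∧ SizeSimilar m c.2 c'.2

/-- Completeness of the search: the refinement by `x` itself need not be listed, since its finite
parts may be too large, but one similar to it at level `m` is. -/
theorem Describes.exists_mem_splits {n : ℕ} {a : Fin n → Set ℕ} {σ : Partition} {X : Set ℕ}
    (m : ℕ) (h : Describes a σ X) (x : Set ℕ) : ∃ τ ∈ splits m σ, ∃ τ', PartitionSimilar m τ' τ ∧
      Describes (Fin.snoc a x : Fin (n + 1) → Set ℕ) τ' X := by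
  induction σ generalizing X with
  | nil => exact ⟨[], by simp [splits], [], List.Forall₂.nil, h⟩
  | cons c σ ih =>
    obtain ⟨hl, Y, hY, hc, hp, hr⟩ := h
    obtain ⟨τ, hτ, τ', hsim, hd⟩ := ih hr
    obtain ⟨z, hz, z₁, z₂, h1, h2, h3, h4⟩ :=
      exists_mem_sizeSplits m hc (Set.inter_subset_left (s := Y) (t := x))
    exact ⟨_, mem_splits_cons.2 ⟨z, hz, τ, hτ, rfl⟩,
      (c.1 ++ [true], z₁) :: (c.1 ++ [false], z₂) :: τ',
      List.Forall₂.cons ⟨rfl, h3⟩ (List.Forall₂.cons ⟨rfl, h4⟩ hsim),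
      Describes.cons_cons hl hY Set.inter_subset_left rfl h1 h2 hp hd⟩

theorem PartitionSimilar.mass {m : ℕ} {σ τ : Partition} (h : PartitionSimilar m σ τ)
    (P : List Bool → Bool) : SizeSimilar m (mass P σ) (mass P τ) := by
  induction h with
  | nil => exact ⟨Or.inl rfl, Iff.rfl⟩
  | cons hc _ ih =>
    obtain ⟨hv, h1, h2⟩ := hc
    obtain ⟨h3, h4⟩ := ih
    rw [SizeSimilar, mass_cons, mass_cons, ← hv]
    split_ifs
    · refine ⟨?_, ?_⟩
      · rcases h1 with h1 | h1
        · rcases h3 with h3 | h3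
          · exact Or.inl (by rw [h1, h3])
          · exact Or.inr ⟨h3.1.trans le_add_self, h3.2.trans le_add_self⟩
        · exact Or.inr ⟨h1.1.trans le_self_add, h1.2.trans le_self_add⟩
      · rw [ENat.add_eq_top, ENat.add_eq_top]
        exact or_congr h2 h4
    · rw [zero_add, zero_add]
      exact ⟨h3, h4⟩

theorem similar_set_of_sizeSimilar {m : ℕ} {s t : Set ℕ} {z z' : SizeCode}
    (hs : s.encard = z.toENat)
    (ht : t.encard = z'.toENat) (h : SizeSimilar m z z') : Similar m s t := by
  rw [SizeSimilar, ← hs, ← ht] at h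
  rw [Similar, size, size, encard_atomsBelow_set, encard_atomsBelow_set]
  refine ⟨h.1, ?_⟩
  change s.Finite ↔ t.Finite
  rw [← not_iff_not, ← Set.encard_ne_top_iff, ← Set.encard_ne_top_iff, not_not, not_not]
  exact h.2

theorem Describes.tupleSimilar {n m : ℕ} {e : Empty → Set ℕ} {a b : Fin n → Set ℕ} {σ τ : Partition}
    (ha : Describes a σ Set.univ) (hb : Describes b τ Set.univ) (h : PartitionSimilar m σ τ) :
    TupleSimilar m (Sum.elim e a)
      (Sum.elim e b) := by
  intro w
  have key : ∀ (a : Fin n → Set ℕ) (v : List Bool) (p : ℕ),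
      (∀ i : Fin n, p ∈ a i ↔ v.getD i false = true) →
      (p ∈ cell (Sum.elim e a) w ↔
        decide (∀ i : Fin n, v.getD i false = w (Sum.inr i)) = true) := by
    intro a v p hp
    have := atom_le_cell_iff (Set.isAtom_singleton p) (Sum.elim e a) w
    rw [Set.singleton_subset_iff] at this
    rw [this, Sum.forall, decide_eq_true_iff]
    simp only [IsEmpty.forall_iff, true_and, Sum.elim_inr,
      Set.singleton_subset_iff]
    refine forall_congr' fun i => ?_
    rw [hp i]
    exact Bool.eq_iff_iff.symm
  have h1 := ha.encard_inter (key a)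
  have h2 := hb.encard_inter (key b)
  rw [Set.univ_inter] at h1 h2
  exact similar_set_of_sizeSimilar h1 h2 (h.mass _)

/-- A quantifier doubles the level but increases the code by at least one. This lets `truth` use a
bound computed from the code alone. -/
theorem level_le_two_pow_code {n : ℕ} (φ : lang.BoundedFormula Empty n) :
    level φ ≤ 2 ^ code φ := by
  induction φ with
  | falsum => exact Nat.one_le_two_pow
  | equal s t => exact Nat.one_le_two_pow
  | rel r ts =>
    cases r with
    | C k =>
      rw [level, code]
      have h1 := Nat.left_le_pair k (termCode (ts 0))
      have h2 := Nat.right_le_pair 2 (Nat.pair k (termCode (ts 0)))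
      exact (h1.trans h2).trans Nat.lt_two_pow_self.le
    | fin => exact Nat.one_le_two_pow
  | imp φ ψ ih1 ih2 =>
    rw [level, code]
    have h1 := Nat.left_le_pair (code φ) (code ψ)
    have h2 := Nat.right_le_pair (code φ) (code ψ)
    have h3 := Nat.right_le_pair 4 (Nat.pair (code φ) (code ψ))
    exact max_le (ih1.trans (Nat.pow_le_pow_right (by norm_num) (h1.trans h3)))
      (ih2.trans (Nat.pow_le_pow_right (by norm_num) (h2.trans h3)))
  | all φ ih =>
    rw [level, code]
    have h := Nat.add_le_pair 5 (code φ)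
    calc 2 * level φ ≤ 2 ^ (code φ + 1) := by rw [pow_succ, mul_comm]; omega
      _ ≤ _ := Nat.pow_le_pow_right (by norm_num) (by omega)

theorem truth_code_iff {n : ℕ} (φ : lang.BoundedFormula Empty n) {σ : Partition}
    {e : Empty → Set ℕ}
    {a : Fin n → Set ℕ} (h : Describes a σ Set.univ) :
    truth σ (code φ) = true ↔ φ.Realize e a := by
  induction φ generalizing σ with
  | falsum =>
    rw [truth, formulaRec]
    simp [code, atomicTruth, BoundedFormula.Realize]
  | equal s t =>
    have hm := h.encard_inter (S := symmDiff (s.realize (Sum.elim e a))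
      (t.realize (Sum.elim e a)))
      (P := fun v => xor (termValue v (termCode s)) (termValue v (termCode t))) fun v p hp => by
        rw [Set.mem_symmDiff, mem_realize_iff s v p hp, mem_realize_iff t v p hp]
        cases termValue v (termCode s) <;> cases termValue v (termCode t) <;> simp
    change _ ↔ s.realize (Sum.elim e a) = t.realize (Sum.elim e a)
    rw [← symmDiff_eq_bot (a := s.realize (Sum.elim e a)), Set.bot_eq_empty, ← Set.encard_eq_zero]
    rw [Set.univ_inter] at hm
    rw [hm, truth, formulaRec]
    simp only [code, atomicTruth, Nat.unpair_pair, OfNat.one_ne_ofNat, dite_false, if_true,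
      decide_eq_true_iff]
    generalize BoolFin.mass _ σ = z
    obtain ⟨b, j⟩ := z
    cases b <;> simp [SizeCode.toENat]
  | rel r ts =>
    have hm : ∀ t : lang.Term _, (t.realize (Sum.elim e a)).encard =
        (BoolFin.mass (fun v => termValue v (termCode t)) σ).toENat := fun t => by
      rw [← h.encard_inter fun v p hp => mem_realize_iff t v p hp, Set.univ_inter]
    cases r with
    | C k =>
      change _ ↔ Structure.RelMap _ _
      rw [relMap_C_iff, size, encard_atomsBelow_set, hm, truth, formulaRec]
      simp [code, atomicTruth]
      generalize BoolFin.mass _ σ = z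
      obtain ⟨b, j⟩ := z
      cases b <;> simp [SizeCode.toENat]
    | fin =>
      change _ ↔ Structure.RelMap _ _
      rw [relMap_fin_iff, isFin_set, ← Set.encard_ne_top_iff, hm, truth, formulaRec]
      simp [code, atomicTruth]
      generalize BoolFin.mass _ σ = z
      obtain ⟨b, j⟩ := z
      cases b <;> simp [SizeCode.toENat]
  | imp φ ψ ih1 ih2 =>
    rw [BoundedFormula.realize_imp, ← ih1 h, ← ih2 h, truth, formulaRec]
    simp only [code, Nat.unpair_pair, dite_true]
    simp only [← truth.eq_1]
    cases truth σ (code φ) <;> simp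
  | all φ ih =>
    rw [BoundedFormula.realize_all, truth, formulaRec]
    simp only [code, Nat.unpair_pair, dite_true]
    simp only [← truth.eq_1]
    simp
    constructor
    · intro hall x
      -- An arbitrary `x` is replaced by a set `y` realizing a listed refinement `τ`; the induction
      -- hypothesis applies to `y`, and similarity carries the truth of `φ` back to `x`.
      obtain ⟨τ, hτ, τ', hsim, hd⟩ := h.exists_mem_splits (2 ^ code φ) x
      obtain ⟨y, -, hy⟩ := h.exists_of_mem_splits hτ
      exact (realize_iff_of_tupleSimilar φ (level_le_two_pow_code φ)
        (hd.tupleSimilar hy hsim)).2 ((ih hy).1 (hall τ hτ))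
    · intro hall τ hτ
      obtain ⟨y, -, hy⟩ := h.exists_of_mem_splits hτ
      exact (ih hy).2 (hall y)

theorem T₂_isDecidable : IsDecidable T₂ := by
  -- The empty tuple generates one cell, all of `ℕ`, with empty profile and infinite size.
  have hinit (a : Fin 0 → Set ℕ) : Describes a [([], (true, 0))] Set.univ :=
    ⟨rfl, Set.univ, subset_rfl, Set.encard_eq_top_iff.2 Set.infinite_univ,
      fun _ _ i => i.elim0, by simp [Describes]⟩
  have hc : ComputablePred fun m : ℕ =>
      (formulaValid 0 m && truth [([], (true, 0))] m) = true := by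
    have := Primrec.and.comp (formulaValid_primrec.comp (Primrec.const 0) Primrec.id)
      (truth_primrec.comp (Primrec.const [([], (true, 0))]) Primrec.id)
    exact ⟨inferInstance, (this.to_comp).of_eq fun m => by simp⟩
  refine hc.of_eq fun m => ?_
  rw [Bool.and_eq_true_iff]
  constructor
  · rintro ⟨h1, h2⟩
    obtain ⟨φ, rfl⟩ := exists_code_eq m h1
    exact ⟨φ, rfl, (realize_powerset_iff ℕ φ).1 ((truth_code_iff φ (hinit _)).1 h2)⟩
  · rintro ⟨φ, rfl, h⟩
    exact ⟨formulaValid_code φ, (truth_code_iff φ (hinit _)).2 ((realize_powerset_iff ℕ φ).2 h)⟩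

end TruthCorrect
end BoolFin

theorem theorem2 :
    BoolFin.T₂.IsComplete ∧
    BoolFin.IsDecidable BoolFin.T₂ ∧
    BoolFin.HasQuantifierElimination BoolFin.T₂ ∧
    ∀ (I : Type*) [Infinite I],
      BoolFin.lang.completeTheory (Set I) = {φ : BoolFin.lang.Sentence | BoolFin.T₂ ⊨ᵇ φ} :=
  ⟨BoolFin.T₂_isComplete, BoolFin.T₂_isDecidable, BoolFin.T₂_hasQuantifierElimination,
    fun I _ => Set.ext fun φ => BoolFin.realize_powerset_iff I φ⟩
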